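/- For complex numbers $s_j=\sigma_j+it_j$ ($j=1,2,3$, $\sigma_j,t_j\in\mathbb R$) let $\zeta_{AV,2}(s_1,s_2,s_3)$ be the Apostol–Vu double zeta-function, i.e. the meromorphic continuation to $\mathbb C^3$ of the series $$\sum_{m=1}^{\infty}\ \sum_{1\le n<m}\frac{1}{m^{s_1}n^{s_2}(m+n)^{s_3}}\qquad(\sigma_1,\sigma_2,\sigma_3>1),$$ whose singularities lie on the hyperplanes $s_1+s_3=1-l$ and $s_1+s_2+s_3=2-l$ ($l=0,1,2,\dots$). Let $$\zeta_{AV,2}^{[2]}(s_1,s_2,s_3)=\sum_{k=2}^{\infty}\left|\sum_{k/2<m\le k-1}\frac{1}{m^{s_1}(k-m)^{s_2}}\right|^2\frac{1}{k^{s_3}} .$$ **Theorem.** Fix $s_1,s_2\in\mathbb C$ and $\sigma_3\in\mathbb R$ with $\sigma_1\ge 0$, $t_1\ge 0$, $\sigma_3>0$, $\sigma_1+\sigma_3>\frac12$ and $\frac32<\sigma_1+\sigma_2+\sigma_3\le 2$. Assume that for no $t_3\ge 2$ the point $(s_1,s_2,\sigma_3+it_3)$ lies on one of the hyperplanes $s_1+s_3=1$,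 $s_1+s_2+s_3=2$. Then the series $\zeta_{AV,2}^{[2]}(s_1,s_2,2\sigma_3)$ converges absolutely, the integral below exists for every $T\ge 2$, and, as $T\to\infty$, $$\int_2^T\left|\zeta_{AV,2}(s_1,s_2,\sigma_3+it_3)\right|^2dt_3=\zeta_{AV,2}^{[2]}(s_1,s_2,2\sigma_3)\,T+\begin{cases}O\!\left(T^{2-2\sigma_1-2\sigma_3}\log T\right)&\text{if }\sigma_2\ge\frac12+\sigma_1+\sigma_3,\\[2pt] O\!\left(T^{\frac52-\sigma_1-\sigma_2-\sigma_3}\right)&\text{if }\sigma_2<\frac12+\sigma_1+\sigma_3\text{ and }\sigma_1+\sigma_2+\sigma_3<2,\\[2pt] O\!\left((T\log T)^{\frac12}\right)&\text{if }\sigma_2<\frac12+\sigma_1+\sigma_3\text{ and }\sigma_1+\sigma_2+\sigma_3=2,\end{cases}$$ where the implicit constants depend only on $s_1$, $s_2$ and $\sigma_3$. -/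

import Mathlib

open Asymptotics Filter

noncomputable section

/-- The Apostol-Vu double series `∑_{m ≥ 1} ∑_{1 ≤ n < m} 1 / (m^{s₁} n^{s₂} (m+n)^{s₃})`. -/
def avSeries (s₁ s₂ s₃ : ℂ) : ℂ :=
  ∑' m : ℕ, ∑ n ∈ Finset.Ico 1 m, 1 / ((m : ℂ) ^ s₁ * (n : ℂ) ^ s₂ * ((m : ℂ) + (n : ℂ)) ^ s₃)

/-- The points `(s₁, s₂, s₃)` with `Re (s₁ + s₃) > 1 - N` and `Re (s₁ + s₂ + s₃) > 2 - N` that lie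
on none of the hyperplanes `s₁ + s₃ = 1 - l` and `s₁ + s₂ + s₃ = 2 - l` (`l = 0, 1, 2, …`).
Each of these sets is open and connected and contains the region `Re s₁, Re s₂, Re s₃ > 1`;
they increase with `N`, and their union is `ℂ³` without all those hyperplanes. -/
def avDomain (N : ℕ) : Set (ℂ × ℂ × ℂ) :=
  {p | 1 - (N : ℝ) < (p.1 + p.2.2).re ∧ 2 - (N : ℝ) < (p.1 + p.2.1 + p.2.2).re ∧
    ∀ l : ℕ, p.1 + p.2.2 ≠ 1 - (l : ℂ) ∧ p.1 + p.2.1 + p.2.2 ≠ 2 - (l : ℂ)}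

/-- `F` is the holomorphic continuation to `avDomain N` of the Apostol-Vu series, which is given
in the region `Re s₁, Re s₂, Re s₃ > 1`. -/
def IsAVContinuation (N : ℕ) (F : ℂ × ℂ × ℂ → ℂ) : Prop :=
  DifferentiableOn ℂ F (avDomain N) ∧
    ∀ s₁ s₂ s₃ : ℂ, 1 < s₁.re → 1 < s₂.re → 1 < s₃.re → F (s₁, s₂, s₃) = avSeries s₁ s₂ s₃

open Classical in
/-- The Apostol-Vu double zeta-function: the analytic continuation of the Apostol-Vu series to `ℂ³`
without the hyperplanes `s₁ + s₃ = 1 - l` and `s₁ + s₂ + s₃ = 2 - l`. By the identity theorem the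
value does not depend on the choice of `N` and of the continuation. (At a point that no such
continuation reaches, in particular on the hyperplanes, the value is set to `0`.) -/
def avZeta (s₁ s₂ s₃ : ℂ) : ℂ :=
  if h : ∃ F : ℂ × ℂ × ℂ → ℂ, ∃ N : ℕ, IsAVContinuation N F ∧ (s₁, s₂, s₃) ∈ avDomain N then
    h.choose (s₁, s₂, s₃)
  else 0

/-- The `k`-th term `|∑_{k/2 < m ≤ k-1} m^{-s₁} (k-m)^{-s₂}|² k^{-s₃}`; it is `0` for `k < 2`. -/
def avSquareTerm (s₁ s₂ s₃ : ℂ) (k : ℕ) : ℂ :=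
  ((‖∑ m ∈ (Finset.Ico 1 k).filter (fun m => k < 2 * m),
      1 / ((m : ℂ) ^ s₁ * ((k : ℂ) - (m : ℂ)) ^ s₂)‖ ^ 2 : ℝ) : ℂ) * (1 / (k : ℂ) ^ s₃)

/-- `ζ_{AV,2}^{[2]}(s₁, s₂, s₃)`: the sum of the terms above over `k ≥ 2`. -/
def avSquare (s₁ s₂ s₃ : ℂ) : ℂ :=
  ∑' k : ℕ, avSquareTerm s₁ s₂ s₃ k

end

/-! Put a = σ₁ + σ₃, b = σ₁ + σ₂ + σ₃ and w = s₁ + s₃. Grouping by k = m + n turns the double series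
into a Dirichlet series in s₃ with coefficients `avCoeff`. Since m > k/2, its coefficients on the
line Re s₃ = σ₃ are O(k^{-α}) for every α ≤ a with α < b - 1 (`exists_norm_avCoeff_le`). The theorem
follows from one estimate: for each such α in (1/2, 1) the error is O(T^{2-2α} log T)
(`avZeta_mean_square_isBigO`).

On [T, 2T] the function equals a Dirichlet polynomial over k ≤ 2M with M ≍ T, up to O(M^{-α})
(`exists_norm_avRest_le`). In the mean square of the polynomial the diagonal gives the main term,
and the off-diagonal terms contribute O(T^{2-2α} log T) (`sum_sum_rpow_div_log_le`). Dyadic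
intervals are then added up.

For the approximation, fix n and let K = 2 max(n, M). The sum of (k-n)^{-s₁} k^{-s₃} over k > K is
expanded in powers of n/k, which leaves tails of the zeta series at w + j. Each tail is
K^{1-w-j}/(w+j-1) plus `zetaTail K (w + j)`. The explicit parts carry a factor 1/|t| that offsets
the extra factor K; those with n > M add up to one further zeta tail, at s₁ + s₂ + s₃ - 1. The
defects need a bound without the factor |w| that a termwise estimate produces; this is
`exists_norm_zetaTail_le`, where the condition K ≫ |w| enters. The same decomposition provides the
analytic continuation, which `avZeta_eq_of_isAVContinuation` identifies with `avZeta`.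

The three cases are choices of α. If σ₂ ≥ 1/2 + a, then α = a is admissible. Otherwise some
admissible α exceeds b/2 - 1/4, so that 2 - 2α < 5/2 - b and the logarithm is absorbed; this also
covers b = 2. -/

/-! ### Holomorphy of locally normally convergent series. -/

open Topology in
-- Cauchy's estimate on each complex line through `x`. The radius is halved to keep the circle
-- inside the open ball; the constant 4 is not sharp.
lemma norm_fderiv_le_of_forall_ball {E : Type*} [NormedAddCommGroup E] [NormedSpace ℂ E]
    {f : E → ℂ} {x : E} {r C : ℝ} (hr : 0 < r) (hf : DifferentiableOn ℂ f (Metric.ball x r))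
    (hC : ∀ y ∈ Metric.ball x r, ‖f y‖ ≤ C) : ‖fderiv ℂ f x‖ ≤ C * (4 / r) := by
  have hC0 : 0 ≤ C := (norm_nonneg _).trans (hC x (Metric.mem_ball_self hr))
  refine ContinuousLinearMap.opNorm_le_of_ball (ε := r / 2) (by positivity) (by positivity) ?_
  intro v hv
  rw [mem_ball_zero_iff] at hv
  have hfx : DifferentiableAt ℂ f x := hf.differentiableAt (Metric.ball_mem_nhds x hr)
  by_cases hv0 : v = 0
  · simp [hv0]
  have hvpos : 0 < ‖v‖ := norm_pos_iff.2 hv0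
  have hmaps : Set.MapsTo (fun z : ℂ => x + z • v) (Metric.ball 0 (r / ‖v‖)) (Metric.ball x r) := by
    intro z hz
    rw [mem_ball_zero_iff] at hz
    rw [Metric.mem_ball, dist_eq_norm]
    simpa [norm_smul] using (lt_div_iff₀ hvpos).1 hz
  have hd : DifferentiableOn ℂ (fun z : ℂ => f (x + z • v)) (Metric.ball 0 (r / ‖v‖)) := by
    refine DifferentiableOn.comp (g := f) hf ?_ hmaps
    fun_prop
  have hR : 0 < r / ‖v‖ / 2 := by positivity
  have hsub : Metric.closedBall (0 : ℂ) (r / ‖v‖ / 2) ⊆ Metric.ball 0 (r / ‖v‖) :=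
    Metric.closedBall_subset_ball (by linarith)
  have hder := Complex.norm_deriv_le_of_forall_mem_sphere_norm_le (c := 0) (C := C) hR
    (hd.diffContOnCl_ball hsub) (fun z hz => hC _ (hmaps (hsub (Metric.sphere_subset_closedBall hz))))
  have hval : deriv (fun z : ℂ => f (x + z • v)) 0 = fderiv ℂ f x v := by
    have h1 : HasFDerivAt f (fderiv ℂ f x) (x + (0 : ℂ) • v) := by simpa using hfx.hasFDerivAt
    have h2 : HasDerivAt (fun z : ℂ => x + z • v) v 0 := by
      simpa using ((hasDerivAt_id (0 : ℂ)).smul_const v).const_add x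
    exact (h1.comp_hasDerivAt (0 : ℂ) h2).deriv
  rw [hval] at hder
  refine hder.trans (le_of_eq_of_le (b := C * (2 / r) * ‖v‖) ?_ ?_)
  · field_simp
  · gcongr; norm_num

open Topology in
/-- A series of holomorphic functions on an open subset of a complex normed space is holomorphic,
if it is normally convergent near every point. -/
lemma differentiableOn_tsum_of_locally_summable {ι E : Type*} [NormedAddCommGroup E]
    [NormedSpace ℂ E] {f : ι → E → ℂ} {U : Set E} (hU : IsOpen U)
    (hf : ∀ i, DifferentiableOn ℂ (f i) U)
    (hb : ∀ x ∈ U, ∃ u : ι → ℝ, Summable u ∧ ∀ᶠ y in 𝓝 x, ∀ i, ‖f i y‖ ≤ u i) :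
    DifferentiableOn ℂ (fun y => ∑' i, f i y) U := by
  intro x hx
  obtain ⟨u, hu, hev⟩ := hb x hx
  obtain ⟨r, hr, hball⟩ := Metric.mem_nhds_iff.1 (hev.and (hU.mem_nhds hx))
  -- Halving the radius leaves room for a Cauchy ball around every point of the smaller ball, so the
  -- majorant `u` also controls the derivatives.
  have hr2 : 0 < r / 2 := by positivity
  have hsub : ∀ y ∈ Metric.ball x (r / 2), Metric.ball y (r / 2) ⊆ Metric.ball x r := by
    intro y hy
    refine Metric.ball_subset_ball' ?_
    have := Metric.mem_ball.1 hy
    linarith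
  have hxb : x ∈ Metric.ball x (r / 2) := Metric.mem_ball_self hr2
  refine (HasFDerivAt.differentiableAt (hasFDerivAt_tsum_of_isPreconnected
    (f' := fun i y => fderiv ℂ (f i) y) (hu.mul_right (4 / (r / 2))) Metric.isOpen_ball
    (Metric.isPreconnected_ball (x := x) (r := r / 2)) ?_ ?_ hxb ?_ hxb)).differentiableWithinAt
  · intro i y hy
    exact ((hf i).differentiableAt (hU.mem_nhds (hball
      (hsub y hy (Metric.mem_ball_self hr2))).2)).hasFDerivAt
  · intro i y hy
    exact norm_fderiv_le_of_forall_ball hr2 ((hf i).mono fun z hz => (hball (hsub y hy hz)).2)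
      fun z hz => (hball (hsub y hy hz)).1 i
  · exact Summable.of_norm_bounded hu fun i => (hball (Metric.mem_ball_self hr)).1 i

/-! ### The domain and the uniqueness of the continuation. -/

lemma mem_avDomain_one {p : ℂ × ℂ × ℂ} : p ∈ avDomain 1 ↔
    0 < (p.1 + p.2.2).re ∧ 1 < (p.1 + p.2.1 + p.2.2).re ∧
      p.1 + p.2.2 ≠ 1 ∧ p.1 + p.2.1 + p.2.2 ≠ 2 := by
  simp only [avDomain, Set.mem_ofPred_eq]
  norm_num
  intro h1 h2
  constructor
  · intro h
    simpa using h 0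
  · rintro ⟨h3, h4⟩ l
    rcases Nat.eq_zero_or_pos l with rfl | hl
    · simpa using ⟨h3, h4⟩
    · have hl' : (1 : ℝ) ≤ l := by exact_mod_cast hl
      constructor
      · intro h
        have := congrArg Complex.re h
        simp at this
        linarith
      · intro h
        have := congrArg Complex.re h
        simp at this
        linarith

lemma isOpen_avDomain_one : IsOpen (avDomain 1) := by
  have : avDomain 1 = {p : ℂ × ℂ × ℂ | 0 < (p.1 + p.2.2).re ∧ 1 < (p.1 + p.2.1 + p.2.2).re ∧
      p.1 + p.2.2 ≠ 1 ∧ p.1 + p.2.1 + p.2.2 ≠ 2} := by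
    ext p
    exact mem_avDomain_one
  rw [this]
  have h1 : Continuous fun p : ℂ × ℂ × ℂ => p.1 + p.2.2 := by fun_prop
  have h2 : Continuous fun p : ℂ × ℂ × ℂ => p.1 + p.2.1 + p.2.2 := by fun_prop
  exact (isOpen_lt continuous_const (Complex.continuous_re.comp h1)).inter
    ((isOpen_lt continuous_const (Complex.continuous_re.comp h2)).inter
      ((isOpen_ne_fun h1 continuous_const).inter (isOpen_ne_fun h2 continuous_const)))

/-- If the ray in the real direction `c` meets zero, then `A` is real, and any ray with a nonreal
direction leaves the real line at once. -/
lemma exists_ray_ne_zero (A : ℂ) (hA : A ≠ 0) (c x₀ : ℝ) :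
    ∃ x : ℝ, ∀ r : ℝ, 0 ≤ r → A + r * ((c : ℂ) + ((x₀ + x : ℝ) : ℂ) * Complex.I) ≠ 0 := by
  by_cases h : ∀ r : ℝ, 0 ≤ r → A + r * ((c : ℂ) + ((x₀ + (-x₀) : ℝ) : ℂ) * Complex.I) ≠ 0
  · exact ⟨_, h⟩
  · push Not at h
    obtain ⟨r, -, hr⟩ := h
    refine ⟨1 - x₀, fun r' _ hr' => hA ?_⟩
    have e1 := congrArg Complex.im hr
    have e2 := congrArg Complex.im hr'
    have e3 := congrArg Complex.re hr'
    simp at e1 e2 e3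
    have : r' = 0 := by linarith
    apply Complex.ext <;> simp_all

open Topology in
-- The identity theorem in one variable, along a complex line from the given point into the region
-- of convergence; connectedness of the domain in ℂ³ is never needed.
lemma avZeta_eq_of_isAVContinuation {F : ℂ × ℂ × ℂ → ℂ} (hF : IsAVContinuation 1 F)
    {s₁ s₂ s₃ : ℂ} (hp : (s₁, s₂, s₃) ∈ avDomain 1) : avZeta s₁ s₂ s₃ = F (s₁, s₂, s₃) := by
  have hex : ∃ F : ℂ × ℂ × ℂ → ℂ, ∃ N : ℕ, IsAVContinuation N F ∧ (s₁, s₂, s₃) ∈ avDomain N :=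
    ⟨F, 1, hF, hp⟩
  rw [avZeta, dif_pos hex]
  obtain ⟨N, hH, hpN⟩ := hex.choose_spec
  set H := hex.choose
  obtain ⟨h1, h2, h3, h4⟩ := mem_avDomain_one.1 hp
  simp only at h1 h2 h3 h4
  obtain ⟨x, hx⟩ := exists_ray_ne_zero (s₁ + s₃ - 1) (sub_ne_zero.2 h3) 2 0
  obtain ⟨y, hy⟩ := exists_ray_ne_zero (s₁ + s₂ + s₃ - 2) (sub_ne_zero.2 h4) 3 x
  -- Along real `z ≥ 0` both s₁ + s₃ and s₁ + s₂ + s₃ have growing real parts, so only the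
  -- hyperplanes with l = 0 can be met; the slopes `x` and `y` steer around them.
  set γ : ℂ → ℂ × ℂ × ℂ := fun z => (s₁ + z, s₂ + z * (1 + y * Complex.I),
    s₃ + z * (1 + x * Complex.I)) with hγ
  have hγd : Differentiable ℂ γ := by
    rw [hγ]; fun_prop
  -- The chosen continuation may have `N = 0` and so live on a smaller set than `avDomain 1`; both
  -- functions are compared on the intersection.
  set D : Set (ℂ × ℂ × ℂ) := avDomain 1 ∩ {p | 1 - (N : ℝ) < (p.1 + p.2.2).re ∧
    2 - (N : ℝ) < (p.1 + p.2.1 + p.2.2).re} with hD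
  have hDo : IsOpen D := by
    have h1 : Continuous fun p : ℂ × ℂ × ℂ => p.1 + p.2.2 := by fun_prop
    have h2 : Continuous fun p : ℂ × ℂ × ℂ => p.1 + p.2.1 + p.2.2 := by fun_prop
    exact isOpen_avDomain_one.inter ((isOpen_lt continuous_const
      (Complex.continuous_re.comp h1)).inter
      (isOpen_lt continuous_const (Complex.continuous_re.comp h2)))
  have hDN : D ⊆ avDomain N := fun p hp => ⟨hp.2.1, hp.2.2, hp.1.2.2⟩
  set R : ℝ := 2 + |s₁.re| + |s₂.re| + |s₃.re|
  have hR0 : 0 ≤ R := by positivity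
  have hseg : segment ℝ (0 : ℂ) (R : ℂ) ⊆ γ ⁻¹' D := by
    intro z hz
    rw [segment_eq_image] at hz
    obtain ⟨θ, hθ, rfl⟩ := hz
    have hr : 0 ≤ θ * R := mul_nonneg hθ.1 hR0
    have hz : (1 - θ) • (0 : ℂ) + θ • (R : ℂ) = ((θ * R : ℝ) : ℂ) := by simp
    simp only [hz]
    generalize θ * R = r at hr
    have e1 : (γ r).1 + (γ r).2.2 = s₁ + s₃ + r * (2 + x * Complex.I) := by simp [hγ]; ring
    have e2 : (γ r).1 + (γ r).2.1 + (γ r).2.2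
        = s₁ + s₂ + s₃ + r * (3 + (x + y : ℝ) * Complex.I) := by simp [hγ]; ring
    have e1' : ((γ r).1 + (γ r).2.2).re = (s₁ + s₃).re + r * 2 := by rw [e1]; simp
    have e2' : ((γ r).1 + (γ r).2.1 + (γ r).2.2).re = (s₁ + s₂ + s₃).re + r * 3 := by
      rw [e2]; simp
    have hpN1 : 1 - (N : ℝ) < (s₁ + s₃).re := hpN.1
    have hpN2 : 2 - (N : ℝ) < (s₁ + s₂ + s₃).re := hpN.2.1
    refine ⟨mem_avDomain_one.2 ⟨?_, ?_, ?_, ?_⟩, ?_, ?_⟩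
    · rw [e1']; linarith
    · rw [e2']; linarith
    · rw [e1]
      intro h
      apply hx r hr
      push_cast
      rw [zero_add]
      linear_combination h
    · rw [e2]
      intro h
      apply hy r hr
      push_cast at h ⊢
      linear_combination h
    · rw [e1']; linarith
    · rw [e2']; linarith
  have hcomp : IsCompact (segment ℝ (0 : ℂ) (R : ℂ)) := by
    rw [segment_eq_image]
    exact isCompact_Icc.image (by fun_prop)
  obtain ⟨δ, hδ, hδU⟩ := hcomp.exists_thickening_subset_open
    (hDo.preimage hγd.continuous) hseg
  set U := Metric.thickening δ (segment ℝ (0 : ℂ) (R : ℂ)) with hU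
  have hUo : IsOpen U := Metric.isOpen_thickening
  have hUc : IsPreconnected U := ((convex_segment _ _).thickening δ).isPreconnected
  have hRU : (R : ℂ) ∈ U := Metric.self_subset_thickening hδ _ (right_mem_segment _ _ _)
  have h0U : (0 : ℂ) ∈ U := Metric.self_subset_thickening hδ _ (left_mem_segment _ _ _)
  have hfa : AnalyticOnNhd ℂ (fun z => H (γ z)) U :=
    DifferentiableOn.analyticOnNhd ((hH.1.mono hDN).comp hγd.differentiableOn hδU) hUo
  have hga : AnalyticOnNhd ℂ (fun z => F (γ z)) U :=
    DifferentiableOn.analyticOnNhd ((hF.1.mono Set.inter_subset_left).comp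
      hγd.differentiableOn hδU) hUo
  have hev : (fun z => H (γ z)) =ᶠ[𝓝 (R : ℂ)] fun z => F (γ z) := by
    have c1 : Continuous fun z => (γ z).1.re := by fun_prop
    have c2 : Continuous fun z => (γ z).2.1.re := by fun_prop
    have c3 : Continuous fun z => (γ z).2.2.re := by fun_prop
    have g1 : 1 < (γ R).1.re := by
      simp [hγ]; linarith [neg_abs_le s₁.re, abs_nonneg s₂.re, abs_nonneg s₃.re]
    have g2 : 1 < (γ R).2.1.re := by
      simp [hγ]; linarith [neg_abs_le s₂.re, abs_nonneg s₁.re, abs_nonneg s₃.re]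
    have g3 : 1 < (γ R).2.2.re := by
      simp [hγ]; linarith [neg_abs_le s₃.re, abs_nonneg s₂.re, abs_nonneg s₁.re]
    filter_upwards [c1.continuousAt.eventually (lt_mem_nhds g1),
      c2.continuousAt.eventually (lt_mem_nhds g2),
      c3.continuousAt.eventually (lt_mem_nhds g3)] with z hz1 hz2 hz3
    have e1 := hH.2 (γ z).1 (γ z).2.1 (γ z).2.2 hz1 hz2 hz3
    have e2 := hF.2 (γ z).1 (γ z).2.1 (γ z).2.2 hz1 hz2 hz3
    exact e1.trans e2.symm
  have := hfa.eqOn_of_preconnected_of_eventuallyEq hga hUc hRU hev h0U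
  simpa [hγ] using this

/-! ### Tails of the zeta series by comparison with an integral. -/

noncomputable section

/-- The difference between `(k+1)^{-w}` and `∫_k^{k+1} v^{-w} dv`. -/
def cpowDefect (k : ℕ) (w : ℂ) : ℂ :=
  ((k : ℂ) + 1) ^ (-w) - ((k : ℂ) ^ (1 - w) - ((k : ℂ) + 1) ^ (1 - w)) / (w - 1)

/-- The continuation of `∑_{k > K} k^{-w} - K^{1-w} / (w - 1)` to `Re w > 0`. -/
def zetaTail (K : ℕ) (w : ℂ) : ℂ := ∑' i : ℕ, cpowDefect (K + i) w

end

lemma norm_natCast_cpow_neg {k : ℕ} (hk : 0 < k) (w : ℂ) :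
    ‖(k : ℂ) ^ (-w)‖ = (k : ℝ) ^ (-w.re) := by
  rw [Complex.norm_natCast_cpow_of_pos hk, Complex.neg_re]

lemma norm_cpow_sub_cpow_le {k : ℝ} (hk : 0 < k) {w : ℂ} (hw : -1 ≤ w.re) {u v : ℝ}
    (hu : u ∈ Set.Icc k (k + 1)) (hv : v ∈ Set.Icc k (k + 1)) :
    ‖(u : ℂ) ^ (-w) - (v : ℂ) ^ (-w)‖ ≤ ‖w‖ * k ^ (-w.re - 1) := by
  have hder : ∀ x ∈ Set.Icc k (k + 1), HasDerivWithinAt (fun y : ℝ => (y : ℂ) ^ (-w))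
      (-w * (x : ℂ) ^ (-w - 1)) (Set.Icc k (k + 1)) x := by
    intro x hx
    have hx0 : 0 < x := hk.trans_le hx.1
    have h1 : HasDerivAt (fun y : ℂ => y ^ (-w)) (-w * (x : ℂ) ^ (-w - 1) * 1) (x : ℂ) :=
      (hasDerivAt_id (x : ℂ)).cpow_const (Or.inl (by simpa using hx0))
    simpa using h1.comp_ofReal.hasDerivWithinAt
  have hb : ∀ x ∈ Set.Icc k (k + 1), ‖-w * (x : ℂ) ^ (-w - 1)‖ ≤ ‖w‖ * k ^ (-w.re - 1) := by
    intro x hx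
    have hx0 : 0 < x := hk.trans_le hx.1
    rw [norm_mul, norm_neg, Complex.norm_cpow_eq_rpow_re_of_pos hx0]
    simp only [Complex.sub_re, Complex.neg_re, Complex.one_re]
    gcongr ?_ * ?_
    exact Real.rpow_le_rpow_of_nonpos hk hx.1 (by linarith)
  have := (convex_Icc k (k + 1)).norm_image_sub_le_of_norm_hasDerivWithin_le hder hb hv hu
  refine this.trans ?_
  have h1 : ‖u - v‖ ≤ 1 := by
    rw [Real.norm_eq_abs, abs_le]; constructor <;> linarith [hu.1, hu.2, hv.1, hv.2]
  have : 0 ≤ ‖w‖ * k ^ (-w.re - 1) := by positivity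
  nlinarith

lemma cpowDefect_eq_integral {k : ℕ} (hk : 0 < k) {w : ℂ} (hw : w ≠ 1) :
    cpowDefect k w = ∫ v in (k : ℝ)..(k + 1), (((k : ℂ) + 1) ^ (-w) - (v : ℂ) ^ (-w)) := by
  have hk' : (0 : ℝ) < k := by exact_mod_cast hk
  have h0 : (0 : ℝ) ∉ Set.uIcc (k : ℝ) (k + 1) := by
    rw [Set.uIcc_of_le (by linarith)]
    intro h; linarith [h.1]
  have hw1 : -w ≠ -1 := fun h => hw (neg_injective h)
  have hint : IntervalIntegrable (fun v : ℝ => (v : ℂ) ^ (-w)) MeasureTheory.volume k (k + 1) :=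
    intervalIntegral.intervalIntegrable_cpow (Or.inr h0)
  rw [intervalIntegral.integral_sub (by simp) hint, integral_cpow (Or.inr ⟨hw1, h0⟩)]
  have hw' : w - 1 ≠ 0 := sub_ne_zero.2 hw
  have hw'' : 1 - w ≠ 0 := sub_ne_zero.2 (Ne.symm hw)
  simp only [cpowDefect, intervalIntegral.integral_const, neg_add_eq_sub]
  have : (k : ℝ) + 1 - k = 1 := by ring
  rw [this, one_smul]
  push_cast
  field_simp
  ring

lemma norm_cpowDefect_le {k : ℕ} (hk : 0 < k) {w : ℂ} (hw : w ≠ 1) (hre : -1 ≤ w.re) :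
    ‖cpowDefect k w‖ ≤ ‖w‖ * (k : ℝ) ^ (-w.re - 1) := by
  have hk' : (0 : ℝ) < k := by exact_mod_cast hk
  rw [cpowDefect_eq_integral hk hw]
  have := intervalIntegral.norm_integral_le_of_norm_le_const (a := (k : ℝ)) (b := k + 1)
    (C := ‖w‖ * (k : ℝ) ^ (-w.re - 1))
    (f := fun v : ℝ => (((k : ℂ) + 1) ^ (-w) - (v : ℂ) ^ (-w))) ?_
  · simpa using this
  · intro v hv
    rw [Set.uIoc_of_le (by linarith)] at hv
    have := norm_cpow_sub_cpow_le hk' hre (u := k + 1) (v := v)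
      ⟨by linarith, le_rfl⟩ ⟨hv.1.le, hv.2⟩
    simpa using this

lemma rpow_sub_one_le_sub {a k : ℝ} (ha : 0 < a) (hk : 0 < k) :
    (k + 1) ^ (-a - 1) ≤ (k ^ (-a) - (k + 1) ^ (-a)) / a := by
  have hk1 : 0 < k + 1 := by linarith
  have hcont : ∀ x ∈ Set.Icc k (k + 1), HasDerivAt (fun y : ℝ => y ^ (-a)) (-a * x ^ (-a - 1)) x :=
    fun x hx => Real.hasDerivAt_rpow_const (Or.inl (hk.trans_le hx.1).ne')
  obtain ⟨c, hc, hce⟩ := exists_hasDerivAt_eq_slope (fun y : ℝ => y ^ (-a))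
    (fun x => -a * x ^ (-a - 1)) (show k < k + 1 by linarith)
    (fun x hx => (hcont x hx).continuousAt.continuousWithinAt)
    (fun x hx => hcont x ⟨hx.1.le, hx.2.le⟩)
  simp only [add_sub_cancel_left, div_one] at hce
  rw [le_div_iff₀ ha]
  have : (k + 1) ^ (-a - 1) ≤ c ^ (-a - 1) :=
    Real.rpow_le_rpow_of_nonpos (hk.trans hc.1) hc.2.le (by linarith)
  nlinarith

lemma summable_rpow_add {a : ℝ} (ha : 0 < a) (K : ℕ) :
    Summable fun i : ℕ => ((K + i : ℕ) : ℝ) ^ (-a - 1) := by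
  have : Summable fun i : ℕ => (i : ℝ) ^ (-a - 1) := Real.summable_nat_rpow.2 (by linarith)
  simpa [add_comm] using (summable_nat_add_iff K).2 this

lemma sum_rpow_add_le {a : ℝ} (ha : 0 < a) {K : ℕ} (hK : 0 < K) (N : ℕ) :
    ∑ i ∈ Finset.range N, ((K + i : ℕ) : ℝ) ^ (-a - 1) ≤ (1 + 1 / a) * (K : ℝ) ^ (-a) := by
  have hK' : (1 : ℝ) ≤ K := by exact_mod_cast hK
  have key : ∀ N : ℕ, ∑ i ∈ Finset.range N, ((K + (i + 1) : ℕ) : ℝ) ^ (-a - 1) ≤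
      ((K : ℝ) ^ (-a) - ((K + N : ℕ) : ℝ) ^ (-a)) / a := by
    intro N
    induction N with
    | zero => simp
    | succ N ih =>
      rw [Finset.sum_range_succ]
      have h := rpow_sub_one_le_sub ha (k := ((K + N : ℕ) : ℝ))
        (by exact_mod_cast (by omega : 0 < K + N))
      have e : ((K + N : ℕ) : ℝ) + 1 = ((K + (N + 1) : ℕ) : ℝ) := by push_cast; ring
      rw [e] at h
      calc _ ≤ _ := add_le_add ih h
        _ = _ := by ring
  -- The comparison in `key` begins at index K + 1, so the term at K is bounded separately.
  have h1 : (K : ℝ) ^ (-a - 1) ≤ (K : ℝ) ^ (-a) :=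
    Real.rpow_le_rpow_of_exponent_le hK' (by linarith)
  have h3 : ((K : ℝ) ^ (-a) - ((K + N : ℕ) : ℝ) ^ (-a)) / a ≤ (K : ℝ) ^ (-a) / a := by
    gcongr
    have : 0 ≤ ((K + N : ℕ) : ℝ) ^ (-a) := by positivity
    linarith
  calc ∑ i ∈ Finset.range N, ((K + i : ℕ) : ℝ) ^ (-a - 1)
      ≤ ∑ i ∈ Finset.range (N + 1), ((K + i : ℕ) : ℝ) ^ (-a - 1) :=
        Finset.sum_le_sum_of_subset_of_nonneg (Finset.range_subset_range.2 (by omega))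
          (fun _ _ _ => by positivity)
    _ ≤ (K : ℝ) ^ (-a) / a + (K : ℝ) ^ (-a) := by
        rw [Finset.sum_range_succ']
        exact add_le_add ((key N).trans h3) (by simpa using h1)
    _ = _ := by ring

lemma tsum_rpow_add_le {a : ℝ} (ha : 0 < a) {K : ℕ} (hK : 0 < K) :
    ∑' i : ℕ, ((K + i : ℕ) : ℝ) ^ (-a - 1) ≤ (1 + 1 / a) * (K : ℝ) ^ (-a) :=
  (summable_rpow_add ha K).tsum_le_of_sum_range_le fun N => sum_rpow_add_le ha hK N

lemma summable_cpowDefect {K : ℕ} (hK : 0 < K) {w : ℂ} (hw : w ≠ 1) (hre : 0 < w.re) :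
    Summable fun i : ℕ => cpowDefect (K + i) w :=
  Summable.of_norm_bounded ((summable_rpow_add hre K).mul_left ‖w‖)
    fun i => norm_cpowDefect_le (by omega) hw (by linarith)

lemma norm_zetaTail_le {K : ℕ} (hK : 0 < K) {w : ℂ} (hw : w ≠ 1) (hre : 0 < w.re) :
    ‖zetaTail K w‖ ≤ ‖w‖ * (1 + 1 / w.re) * (K : ℝ) ^ (-w.re) := by
  rw [zetaTail]
  refine (tsum_of_norm_bounded ((summable_rpow_add hre K).mul_left ‖w‖).hasSum
    fun i => norm_cpowDefect_le (by omega) hw (by linarith)).trans ?_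
  rw [tsum_mul_left, mul_assoc]
  gcongr
  exact tsum_rpow_add_le hre hK

lemma differentiableOn_cpowDefect {k : ℕ} (hk : 0 < k) :
    DifferentiableOn ℂ (cpowDefect k) {w | w ≠ 1} := by
  intro w hw
  have hk0 : (k : ℂ) ≠ 0 := by exact_mod_cast hk.ne'
  have hk1 : (k : ℂ) + 1 ≠ 0 := by exact_mod_cast k.succ_ne_zero
  have hw' : w - 1 ≠ 0 := sub_ne_zero.2 hw
  have h1 : DifferentiableAt ℂ (fun w : ℂ => ((k : ℂ) + 1) ^ (-w)) w :=
    (differentiableAt_id.neg).const_cpow (Or.inl hk1)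
  have h2 : DifferentiableAt ℂ (fun w : ℂ => ((k : ℂ) + 1) ^ (1 - w)) w :=
    (differentiableAt_id.const_sub 1).const_cpow (Or.inl hk1)
  have h3 : DifferentiableAt ℂ (fun w : ℂ => (k : ℂ) ^ (1 - w)) w :=
    (differentiableAt_id.const_sub 1).const_cpow (Or.inl hk0)
  exact (h1.sub ((h3.sub h2).div (differentiableAt_id.sub_const 1) hw')).differentiableWithinAt

lemma isOpen_re_pos_ne_one : IsOpen {w : ℂ | 0 < w.re ∧ w ≠ 1} :=
  (isOpen_lt continuous_const Complex.continuous_re).inter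
    (isOpen_ne_fun continuous_id continuous_const)

lemma differentiableOn_zetaTail {K : ℕ} (hK : 0 < K) :
    DifferentiableOn ℂ (zetaTail K) {w | 0 < w.re ∧ w ≠ 1} := by
  refine differentiableOn_tsum_of_locally_summable isOpen_re_pos_ne_one
    (fun i => (differentiableOn_cpowDefect (by omega)).mono fun w hw => hw.2) ?_
  intro w hw
  have hpos : 0 < w.re / 2 := half_pos hw.1
  refine ⟨fun i => (‖w‖ + 1) * ((K + i : ℕ) : ℝ) ^ (-(w.re / 2) - 1),
    (summable_rpow_add hpos K).mul_left _, ?_⟩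
  filter_upwards [isOpen_re_pos_ne_one.mem_nhds hw,
    Complex.continuous_re.continuousAt.eventually (lt_mem_nhds (half_lt_self hw.1)),
    continuous_norm.continuousAt.eventually (gt_mem_nhds (lt_add_one ‖w‖))] with z hz hz1 hz2 i
  refine (norm_cpowDefect_le (by omega) hz.2 (by linarith [hz.1])).trans ?_
  gcongr
  exact_mod_cast (by omega : 1 ≤ K + i)

lemma cpow_one_sub_div_tendsto {w : ℂ} (hw : 1 < w.re) :
    Tendsto (fun k : ℕ => (k : ℂ) ^ (1 - w) / (w - 1)) atTop (nhds 0) := by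
  rw [tendsto_zero_iff_norm_tendsto_zero]
  have h : Tendsto (fun k : ℕ => (k : ℝ) ^ (-(w.re - 1)) / ‖w - 1‖) atTop (nhds 0) := by
    simpa using ((tendsto_rpow_neg_atTop (by linarith : 0 < w.re - 1)).comp
      tendsto_natCast_atTop_atTop).div_const ‖w - 1‖
  refine h.congr' ?_
  filter_upwards [eventually_gt_atTop 0] with k hk
  rw [norm_div, Complex.norm_natCast_cpow_of_pos hk]
  simp

/-- The integrals subtracted in `cpowDefect` telescope to the single value at `K`, their boundary
term at infinity vanishing because Re w > 1. -/
lemma tsum_cpow_eq {K : ℕ} (hK : 0 < K) {w : ℂ} (hw : 1 < w.re) :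
    ∑' i : ℕ, ((K + 1 + i : ℕ) : ℂ) ^ (-w) = (K : ℂ) ^ (1 - w) / (w - 1) + zetaTail K w := by
  have hw1 : w ≠ 1 := by rintro rfl; simp at hw
  have hs := summable_cpowDefect hK hw1 (by linarith)
  set B : ℕ → ℂ := fun i => ((K + i : ℕ) : ℂ) ^ (1 - w) / (w - 1) with hB
  have hBt : Tendsto B atTop (nhds 0) := by
    have := (cpow_one_sub_div_tendsto hw).comp (tendsto_add_atTop_nat K)
    refine this.congr fun i => ?_
    simp [hB, add_comm]
  have hsum : HasSum (fun i => B i - B (i + 1)) (B 0) := by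
    have h1 : Summable fun i => B i - B (i + 1) := by
      have hz : Summable fun i : ℕ => ((K + 1 + i : ℕ) : ℂ) ^ (-w) := by
        refine Summable.of_norm ?_
        have : Summable fun i : ℕ => ((K + 1 + i : ℕ) : ℝ) ^ (-(w.re - 1) - 1) :=
          summable_rpow_add (by linarith) (K + 1)
        refine this.congr fun i => ?_
        rw [norm_natCast_cpow_neg (by omega)]
        congr 1; ring
      refine (hz.sub hs).congr fun i => ?_
      simp only [cpowDefect, hB]
      push_cast
      rw [← sub_div, add_assoc, add_comm (1 : ℂ) i, ← add_assoc]
      ring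
    have h2 := h1.hasSum.tendsto_sum_nat
    have h3 : Tendsto (fun n => ∑ i ∈ Finset.range n, (B i - B (i + 1))) atTop (nhds (B 0)) := by
      simp only [Finset.sum_range_sub']
      simpa using hBt.const_sub (B 0)
    rw [← tendsto_nhds_unique h2 h3]
    exact h1.hasSum
  have hfin := hsum.add hs.hasSum
  have : (K : ℂ) ^ (1 - w) / (w - 1) + zetaTail K w = B 0 + ∑' i : ℕ, cpowDefect (K + i) w := by
    simp [hB, zetaTail]
  rw [this, ← hfin.tsum_eq]
  refine tsum_congr fun i => ?_
  simp only [cpowDefect, hB]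
  push_cast
  rw [← sub_div, add_assoc, add_comm (1 : ℂ) i, ← add_assoc]
  ring

/-! ### A bound for the zeta tail that is uniform in the height. -/

/-- A simple zero with derivative 1 gives the reciprocal a simple pole with residue 1. Writing f = z
g and g = 1 + z q, the regular part is -q/g, analytic at 0 and hence Lipschitz nearby. -/
lemma exists_lipschitz_inv_sub_inv {f : ℂ → ℂ} (hf : AnalyticAt ℂ f 0) (h0 : f 0 = 0)
    (h1 : deriv f 0 = 1) :
    ∃ r > 0, ∃ L ≥ 0, ∃ β : ℂ → ℂ, (∀ z, ‖z‖ < r → z ≠ 0 → f z ≠ 0 ∧ (f z)⁻¹ = z⁻¹ + β z) ∧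
      (∀ z, ‖z‖ < r → ‖β z‖ ≤ L) ∧
      ∀ z z', ‖z‖ < r → ‖z'‖ < r → ‖β z - β z'‖ ≤ L * ‖z - z'‖ := by
  set g := dslope f 0 with hg
  have hga : AnalyticAt ℂ g 0 := by
    obtain ⟨p, hp⟩ := hf
    exact ⟨_, hp.has_fpower_series_dslope_fslope⟩
  have hg0 : g 0 = 1 := by rw [hg, dslope_same, h1]
  have hgne : ∀ᶠ z in nhds 0, g z ≠ 0 := hga.continuousAt.eventually_ne (by rw [hg0]; simp)
  set q := dslope g 0 with hq
  have hqa : AnalyticAt ℂ q 0 := by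
    obtain ⟨p, hp⟩ := hga
    exact ⟨_, hp.has_fpower_series_dslope_fslope⟩
  have hβa : AnalyticAt ℂ (fun z => -(q z / g z)) 0 := (hqa.div hga (by rw [hg0]; simp)).neg
  obtain ⟨K, s, hs, hlip⟩ := (hβa.contDiffAt (n := 1)).exists_lipschitzOnWith
  obtain ⟨r, hr, hball⟩ := Metric.mem_nhds_iff.1 (inter_mem hgne hs)
  set β : ℂ → ℂ := fun z => -(q z / g z) with hβ
  have hmem : ∀ z : ℂ, ‖z‖ < r → z ∈ Metric.ball (0 : ℂ) r := fun z hz => by simpa using hz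
  have hl : ∀ z z', ‖z‖ < r → ‖z'‖ < r → ‖β z - β z'‖ ≤ K * ‖z - z'‖ := fun z z' hz hz' =>
    hlip.norm_sub_le (hball (hmem z hz)).2 (hball (hmem z' hz')).2
  refine ⟨r, hr, K + K * r + ‖β 0‖, by positivity, β, ?_, ?_, ?_⟩
  · intro z hz hz0
    have hgz : g z ≠ 0 := (hball (hmem z hz)).1
    have e1 : f z = z * g z := by
      rw [hg, dslope_of_ne _ hz0, slope_def_field, h0]; field_simp; ring
    have e2 : q z = (g z - 1) / z := by
      rw [hq, dslope_of_ne _ hz0, slope_def_field, hg0, sub_zero]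
    refine ⟨by rw [e1]; exact mul_ne_zero hz0 hgz, ?_⟩
    simp only [hβ]
    rw [e2, e1]
    field_simp
    ring
  · intro z hz
    have h := hl z 0 hz (by simpa using hr)
    rw [sub_zero] at h
    have h2 : ‖β z‖ ≤ ‖β z - β 0‖ + ‖β 0‖ := by simpa using norm_add_le (β z - β 0) (β 0)
    have h3 : (K : ℝ) * ‖z‖ ≤ K * r := by gcongr
    have : (0 : ℝ) ≤ K := K.2
    linarith
  · intro z z' hz hz'
    refine (hl z z' hz hz').trans ?_
    gcongr
    have : 0 ≤ (K : ℝ) * r := by positivity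
    linarith [norm_nonneg (β 0)]

/-- A device for summation by parts: k^{-w} is a difference of consecutive powers times a slowly
varying factor. That factor behaves like k + O(|w|) as long as |w|/k stays small, because the exact
quotient is w / (1 - e^{-wℓ}) with ℓ = log(1 + 1/k). -/
lemma exists_summation_multiplier : ∃ C ≥ (1 : ℝ), ∃ L ≥ (0 : ℝ), ∀ w : ℂ, 1 ≤ ‖w‖ →
    ∃ p : ℕ → ℂ, ∀ k : ℕ, C * ‖w‖ ≤ k →
      p k * ((k : ℂ) ^ (-w) - ((k + 1 : ℕ) : ℂ) ^ (-w)) = w * (k : ℂ) ^ (-w) ∧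
      ‖p k - k‖ ≤ L * (1 + ‖w‖) ∧ ‖p k - p (k + 1) + 1‖ ≤ L * (1 + ‖w‖) / k := by
  obtain ⟨r₁, hr₁, L₁, hL₁, β, hβ, hβb, hβl⟩ := exists_lipschitz_inv_sub_inv
    (f := fun z => 1 - Complex.exp (-z)) (by fun_prop) (by simp) (by
      have : HasDerivAt (fun z : ℂ => 1 - Complex.exp (-z)) (-(Complex.exp (-0) * (-1))) 0 :=
        ((hasDerivAt_neg (0 : ℂ)).cexp).const_sub 1
      rw [this.deriv]; simp)
  obtain ⟨r₂, hr₂, L₂, hL₂, γ, hγ, hγb, hγl⟩ := exists_lipschitz_inv_sub_inv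
    (f := fun z => Complex.log (1 + z))
    (AnalyticAt.clog (by fun_prop) (by simp)) (by simp) (by
      have : HasDerivAt (fun z : ℂ => Complex.log (1 + z)) (1 / (1 + 0)) 0 :=
        ((hasDerivAt_id (0 : ℂ)).const_add 1).clog (by simp)
      rw [this.deriv]; simp)
  refine ⟨1 + 1 / r₁ + 1 / r₂, by
    have : 0 < 1 / r₁ := by positivity
    have : 0 < 1 / r₂ := by positivity
    linarith, L₁ + L₂, by positivity, fun w hw => ?_⟩
  have hw0 : w ≠ 0 := by rintro rfl; norm_num at hw
  set ℓ : ℕ → ℝ := fun k => Real.log (1 + 1 / k) with hℓ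
  -- This is w / (1 - e^{-wℓ}): the expansion 1/(1 - e^{-z}) = 1/z + β(z) turns it into 1/ℓ + w
  -- β(wℓ), and 1/ℓ = k + γ(1/k).
  refine ⟨fun k => k + γ (1 / k) + w * β (w * ℓ k), fun k hk => ?_⟩
  have hr1' : 0 < 1 / r₁ := by positivity
  have hr2' : 0 < 1 / r₂ := by positivity
  have aux : ∀ m : ℕ, k ≤ m → ‖w‖ ≤ m ∧ 1 ≤ m ∧ ‖(1 / (m : ℂ))‖ < r₂ ∧ ‖w * ℓ m‖ < r₁ ∧ 0 < ℓ m := by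
    intro m hm
    have hkm : (1 + 1 / r₁ + 1 / r₂) * ‖w‖ ≤ m := hk.trans (by exact_mod_cast hm)
    have a1 : ‖w‖ ≤ m := by nlinarith
    have a2 : 1 ≤ (m : ℝ) := hw.trans a1
    have a3 : 1 / r₂ < m := by nlinarith
    have a4 : 1 / r₁ * ‖w‖ < m := by nlinarith
    have hm0 : (0 : ℝ) < m := by linarith
    have hl0 : 0 < ℓ m := Real.log_pos (by
      have : 0 < 1 / (m : ℝ) := by positivity
      linarith)
    have hl1 : ℓ m ≤ 1 / m := by
      have := Real.log_le_sub_one_of_pos (show 0 < 1 + 1 / (m : ℝ) by positivity)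
      simpa [hℓ] using this
    refine ⟨a1, by exact_mod_cast a2, ?_, ?_, hl0⟩
    · rw [norm_div, norm_one, Complex.norm_natCast, div_lt_iff₀ hm0]
      rw [div_lt_iff₀ hr₂] at a3
      linarith
    · rw [norm_mul, Complex.norm_real, Real.norm_of_nonneg hl0.le]
      calc ‖w‖ * ℓ m ≤ ‖w‖ * (1 / m) := by gcongr
        _ < r₁ := by
          rw [mul_one_div, div_lt_iff₀ hm0]
          rw [one_div_mul_eq_div, div_lt_iff₀ hr₁] at a4
          linarith
  obtain ⟨b1, b2, b3, b4, b5⟩ := aux k le_rfl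
  obtain ⟨c1, c2, c3, c4, c5⟩ := aux (k + 1) (by omega)
  have hk0 : (0 : ℝ) < k := by exact_mod_cast b2
  have hkc : (k : ℂ) ≠ 0 := by exact_mod_cast hk0.ne'
  have hlk : (ℓ k : ℂ) ≠ 0 := by exact_mod_cast b5.ne'
  have hstep : ((k + 1 : ℕ) : ℂ) ^ (-w) = (k : ℂ) ^ (-w) * Complex.exp (-(w * ℓ k)) := by
    have hk1c : ((k + 1 : ℕ) : ℂ) ≠ 0 := by exact_mod_cast k.succ_ne_zero
    rw [Complex.cpow_def_of_ne_zero hk1c, Complex.cpow_def_of_ne_zero hkc, ← Complex.exp_add]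
    congr 1
    have : Complex.log ((k + 1 : ℕ) : ℂ) = Complex.log (k : ℂ) + ℓ k := by
      rw [← Complex.natCast_log, ← Complex.natCast_log, ← Complex.ofReal_add, hℓ,
        ← Real.log_mul hk0.ne' (by positivity)]
      congr 2
      push_cast
      field_simp
    rw [this]; ring
  refine ⟨?_, ?_, ?_⟩
  · obtain ⟨d1, d2⟩ := hβ (w * ℓ k) b4 (mul_ne_zero hw0 hlk)
    obtain ⟨-, d3⟩ := hγ (1 / k) b3 (by simpa using hkc)
    have d4 : Complex.log (1 + 1 / (k : ℂ)) = ℓ k := by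
      rw [hℓ]; simp only; rw [Complex.ofReal_log (by positivity)]; push_cast; rfl
    rw [d4, one_div, inv_inv] at d3
    have e : (k : ℂ) + γ (1 / k) + w * β (w * ℓ k) = w * (1 - Complex.exp (-(w * ℓ k)))⁻¹ := by
      rw [d2, one_div, ← d3]; field_simp
    simp only [e, hstep]
    field_simp
  · have : (k : ℂ) + γ (1 / k) + w * β (w * ℓ k) - k = γ (1 / k) + w * β (w * ℓ k) := by ring
    simp only [this]
    refine (norm_add_le _ _).trans ?_
    rw [norm_mul]
    have h1 := hγb _ b3
    have h2 := hβb _ b4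
    have : ‖w‖ * ‖β (w * ℓ k)‖ ≤ ‖w‖ * L₁ := by gcongr
    nlinarith [norm_nonneg w]
  · have e : (k : ℂ) + γ (1 / k) + w * β (w * ℓ k) - (((k + 1 : ℕ) : ℂ) + γ (1 / ((k + 1 : ℕ) : ℂ))
        + w * β (w * ℓ (k + 1))) + 1 = (γ (1 / k) - γ (1 / ((k + 1 : ℕ) : ℂ))) +
        w * (β (w * ℓ k) - β (w * ℓ (k + 1))) := by push_cast; ring
    simp only [e]
    have hdiff : 1 / (k : ℝ) - 1 / ((k + 1 : ℕ) : ℝ) ≤ 1 / (k : ℝ) ^ 2 := by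
      push_cast
      rw [div_sub_div _ _ hk0.ne' (by positivity), div_le_div_iff₀ (by positivity) (by positivity)]
      nlinarith
    have hdiff0 : 0 ≤ 1 / (k : ℝ) - 1 / ((k + 1 : ℕ) : ℝ) := by
      rw [sub_nonneg]
      exact one_div_le_one_div_of_le hk0 (by push_cast; linarith)
    have hx : ‖(1 / (k : ℂ)) - 1 / ((k + 1 : ℕ) : ℂ)‖ ≤ 1 / (k : ℝ) ^ 2 := by
      have : (1 / (k : ℂ)) - 1 / ((k + 1 : ℕ) : ℂ) = ((1 / (k : ℝ) - 1 / ((k + 1 : ℕ) : ℝ) : ℝ) : ℂ) := by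
        push_cast; rfl
      rw [this, Complex.norm_real, Real.norm_of_nonneg hdiff0]
      exact hdiff
    have hle : ‖w * ℓ k - w * ℓ (k + 1)‖ ≤ ‖w‖ * (1 / (k : ℝ) ^ 2) := by
      rw [← mul_sub, norm_mul]
      gcongr
      rw [← Complex.ofReal_sub, Complex.norm_real, Real.norm_eq_abs]
      set x := 1 / (k : ℝ)
      set y := 1 / ((k + 1 : ℕ) : ℝ)
      have hx0 : 0 < x := by positivity
      have hy0 : 0 < y := by positivity
      have h0 : 0 ≤ ℓ k - ℓ (k + 1) := sub_nonneg.2 (Real.log_le_log (by positivity) (by linarith))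
      rw [abs_of_nonneg h0]
      have : ℓ k - ℓ (k + 1) = Real.log ((1 + x) / (1 + y)) := by
        rw [Real.log_div (by positivity) (by positivity)]
      rw [this]
      refine (Real.log_le_sub_one_of_pos (by positivity)).trans (le_trans ?_ hdiff)
      rw [div_sub_one (by positivity), div_le_iff₀ (by positivity)]
      nlinarith
    have h1 := hγl _ _ b3 c3
    have h2 := hβl _ _ b4 c4
    have h1' : ‖γ (1 / k) - γ (1 / ((k + 1 : ℕ) : ℂ))‖ ≤ L₂ * (1 / (k : ℝ)) := by
      refine h1.trans ?_
      gcongr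
      refine hx.trans ?_
      have : (1 : ℝ) ≤ k := by exact_mod_cast b2
      exact one_div_le_one_div_of_le hk0 (by nlinarith)
    have h2' : ‖w‖ * ‖β (w * ℓ k) - β (w * ℓ (k + 1))‖ ≤ L₁ * ‖w‖ * (1 / (k : ℝ)) := by
      calc _ ≤ ‖w‖ * (L₁ * (‖w‖ * (1 / (k : ℝ) ^ 2))) := by
            gcongr; exact h2.trans (by gcongr)
        _ = L₁ * ‖w‖ * (1 / (k : ℝ)) * (‖w‖ / k) := by field_simp
        _ ≤ L₁ * ‖w‖ * (1 / (k : ℝ)) * 1 := by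
            gcongr
            rw [div_le_one hk0]; exact b1
        _ = _ := by ring
    refine (norm_add_le _ _).trans ?_
    rw [norm_mul]
    refine (add_le_add h1' h2').trans ?_
    rw [← mul_one_div ((L₁ + L₂) * (1 + ‖w‖))]
    have h3 : 0 ≤ 1 / (k : ℝ) := by positivity
    have : 0 ≤ L₁ * (1 / (k : ℝ)) := by positivity
    have : 0 ≤ L₂ * ‖w‖ * (1 / (k : ℝ)) := by positivity
    nlinarith

/-- The simplest approximation of the zeta tail, uniform for `K ≫ |w|`. -/
lemma exists_norm_zetaTail_le : ∃ C ≥ (1 : ℝ), ∃ A ≥ (0 : ℝ), ∀ (w : ℂ) (K : ℕ), 0 < w.re →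
    1 ≤ |w.im| → C * ‖w‖ ≤ K → ‖zetaTail K w‖ ≤ A * (1 + 1 / w.re) * (K : ℝ) ^ (-w.re) := by
  obtain ⟨C, hC, L, hL, h⟩ := exists_summation_multiplier
  refine ⟨C, hC, 9 * (1 + L), by positivity, fun w K hre him hK => ?_⟩
  have hw1 : 1 ≤ ‖w‖ := him.trans (Complex.abs_im_le_norm w)
  have hwm : 1 ≤ ‖w - 1‖ := him.trans (by simpa using Complex.abs_im_le_norm (w - 1))
  -- The imaginary part keeps `w` away from 1, so division by w - 1 compensates every factor of size
  -- 1 + |w| below.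
  have hw3 : 1 + ‖w‖ ≤ 3 * ‖w - 1‖ := by
    have : ‖w‖ ≤ ‖w - 1‖ + 1 := by simpa using norm_add_le (w - 1) 1
    linarith
  have hwm0 : 0 < ‖w - 1‖ := by linarith
  have hwne : w - 1 ≠ 0 := norm_pos_iff.1 hwm0
  have hKpos : (0 : ℝ) < K := by nlinarith
  have hK0 : 0 < K := by exact_mod_cast hKpos
  obtain ⟨p, hp⟩ := h w hw1
  have hp' : ∀ i : ℕ, C * ‖w‖ ≤ ((K + i : ℕ) : ℝ) := fun i => hK.trans (by push_cast; simp)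
  set u : ℕ → ℂ := fun k => (k : ℂ) ^ (-w) with hu
  -- Summation by parts: the defect is a difference of consecutive values of `H`, which are O(k^{-Re
  -- w}), minus an error `ρ`, which is O(k^{-Re w - 1}). Both bounds are free of |w| after the
  -- division by w - 1.
  set H : ℕ → ℂ := fun k => u k * ((p k - k) / (w - 1) - 1) with hH
  set ρ : ℕ → ℂ := fun k => (u k - u (k + 1) + u (k + 1) * (p k - p (k + 1) + 1)) / (w - 1) with hρ
  have hy : ∀ i, cpowDefect (K + i) w = H (K + i) - H (K + i + 1) - ρ (K + i) := by
    intro i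
    obtain ⟨h1, -, -⟩ := hp (K + i) (hp' i)
    generalize hk : K + i = k at *
    have hk0 : (k : ℂ) ≠ 0 := by
      have : k ≠ 0 := by omega
      exact_mod_cast this
    have hk1 : ((k + 1 : ℕ) : ℂ) ≠ 0 := by exact_mod_cast k.succ_ne_zero
    have e1 : (k : ℂ) ^ (1 - w) = k * u k := by
      rw [hu, sub_eq_add_neg, Complex.cpow_add _ _ hk0, Complex.cpow_one]
    have e2 : ((k + 1 : ℕ) : ℂ) ^ (1 - w) = (k + 1 : ℕ) * u (k + 1) := by
      rw [hu, sub_eq_add_neg, Complex.cpow_add _ _ hk1, Complex.cpow_one]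
    have h1' : p k * (u k - u (k + 1)) = w * u k := h1
    have : cpowDefect k w = u (k + 1) - (k * u k - (k + 1 : ℕ) * u (k + 1)) / (w - 1) := by
      rw [← e1, ← e2, cpowDefect]; push_cast; simp [hu]
    rw [this]
    simp only [hH, hρ]
    push_cast
    field_simp
    linear_combination -h1'
  have hun : ∀ k : ℕ, 0 < k → ‖u k‖ = (k : ℝ) ^ (-w.re) := fun k hk => norm_natCast_cpow_neg hk w
  have hHn : ∀ i, ‖H (K + i)‖ ≤ (3 * L + 1) * (K : ℝ) ^ (-w.re) := by
    intro i
    obtain ⟨-, h2, -⟩ := hp (K + i) (hp' i)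
    rw [hH]
    simp only
    rw [norm_mul, hun _ (by omega), mul_comm]
    have : ((K + i : ℕ) : ℝ) ^ (-w.re) ≤ (K : ℝ) ^ (-w.re) :=
      Real.rpow_le_rpow_of_nonpos hKpos (by push_cast; simp) (by linarith)
    have h4 : ‖(p (K + i) - ((K + i : ℕ) : ℂ)) / (w - 1) - 1‖ ≤ 3 * L + 1 := by
      refine (norm_sub_le _ _).trans ?_
      rw [norm_one, norm_div]
      gcongr
      rw [div_le_iff₀ hwm0]
      nlinarith
    gcongr
  have hρn : ∀ i, ‖ρ (K + i)‖ ≤ 3 * (1 + L) * ((K + i : ℕ) : ℝ) ^ (-w.re - 1) := by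
    intro i
    obtain ⟨-, -, h3⟩ := hp (K + i) (hp' i)
    generalize hk : K + i = k at *
    have hk0 : 0 < k := by omega
    have hkp : (0 : ℝ) < k := by exact_mod_cast hk0
    rw [hρ]
    simp only
    rw [norm_div, div_le_iff₀ hwm0]
    have h4 : ‖u k - u (k + 1)‖ ≤ ‖w‖ * (k : ℝ) ^ (-w.re - 1) := by
      have := norm_cpow_sub_cpow_le hkp (w := w) (by linarith) (u := k) (v := k + 1)
        ⟨le_rfl, by linarith⟩ ⟨by linarith, le_rfl⟩
      simpa [hu] using this
    have h5 : ‖u (k + 1)‖ ≤ (k : ℝ) ^ (-w.re) := by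
      rw [hun _ k.succ_pos]
      exact Real.rpow_le_rpow_of_nonpos hkp (by push_cast; linarith) (by linarith)
    have h6 : ‖u (k + 1) * (p k - p (k + 1) + 1)‖ ≤ L * (1 + ‖w‖) * (k : ℝ) ^ (-w.re - 1) := by
      rw [norm_mul, Real.rpow_sub_one hkp.ne']
      calc _ ≤ (k : ℝ) ^ (-w.re) * (L * (1 + ‖w‖) / k) := by gcongr
        _ = _ := by ring
    refine (norm_add_le _ _).trans ((add_le_add h4 h6).trans ?_)
    have h7 : 0 ≤ (k : ℝ) ^ (-w.re - 1) := by positivity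
    have : ‖w‖ + L * (1 + ‖w‖) ≤ 3 * (1 + L) * ‖w - 1‖ := by nlinarith
    nlinarith
  have hpart : ∀ N, ‖∑ i ∈ Finset.range N, cpowDefect (K + i) w‖ ≤
      9 * (1 + L) * (1 + 1 / w.re) * (K : ℝ) ^ (-w.re) := by
    intro N
    have e : ∑ i ∈ Finset.range N, cpowDefect (K + i) w
        = H K - H (K + N) - ∑ i ∈ Finset.range N, ρ (K + i) := by
      simp only [hy]
      rw [Finset.sum_sub_distrib]
      congr 1
      have := Finset.sum_range_sub' (fun i => H (K + i)) N
      simpa [add_assoc] using this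
    rw [e]
    have h1 : ‖∑ i ∈ Finset.range N, ρ (K + i)‖ ≤ 3 * (1 + L) * ((1 + 1 / w.re) * (K : ℝ) ^ (-w.re)) := by
      refine (norm_sum_le_of_le _ fun i _ => hρn i).trans ?_
      rw [← Finset.mul_sum]
      gcongr
      exact sum_rpow_add_le hre hK0 N
    have h2 : ‖H K‖ ≤ (3 * L + 1) * (K : ℝ) ^ (-w.re) := by simpa using hHn 0
    have h3 := hHn N
    refine (norm_sub_le _ _).trans ((add_le_add ((norm_sub_le _ _).trans (add_le_add h2 h3)) h1).trans ?_)
    have h7 : 0 ≤ (K : ℝ) ^ (-w.re) := by positivity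
    have h8 : 0 ≤ 1 / w.re := by positivity
    have h9 : 0 ≤ 1 / w.re * (K : ℝ) ^ (-w.re) := by positivity
    have h10 : 0 ≤ L * (1 / w.re * (K : ℝ) ^ (-w.re)) := by positivity
    nlinarith
  have hs := (summable_cpowDefect hK0 (sub_ne_zero.1 hwne) hre).hasSum.tendsto_sum_nat
  exact le_of_tendsto hs.norm (Eventually.of_forall hpart)

/-! ### The binomial expansion of the inner sum. -/

noncomputable section

/-- The coefficient of `x^j` in the binomial series of `(1 - x)^{-s}`. -/
def risingCoeff {𝕜 : Type*} [Field 𝕜] (j : ℕ) (s : 𝕜) : 𝕜 :=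
  ∏ i ∈ Finset.range j, (s + i) / (i + 1)

/-- `∑_j a_j(s) x^j / (w + j - 1)`, a multiple of `∫_K^∞ (v - xK)^{-s} v^{s-w} dv`. -/
def polePart (x : ℝ) (q : ℂ × ℂ) : ℂ :=
  ∑' j : ℕ, risingCoeff j q.1 * (x : ℂ) ^ j / (q.2 + j - 1)

/-- The difference between `∑_{k > K} (k - n)^{-s} k^{s-w}` and `∫_K^∞ (v - n)^{-s} v^{s-w} dv`. -/
def tailPart (n K : ℕ) (q : ℂ × ℂ) : ℂ :=
  ∑' j : ℕ, risingCoeff j q.1 * (n : ℂ) ^ j * zetaTail K (q.2 + j)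

end

lemma factorial_mul_risingCoeff (j : ℕ) (s : ℂ) :
    (j.factorial : ℂ) * risingCoeff j s = (ascPochhammer ℂ j).eval s := by
  induction j with
  | zero => simp [risingCoeff]
  | succ j ih =>
    have h : (j : ℂ) + 1 ≠ 0 := by exact_mod_cast j.succ_ne_zero
    rw [ascPochhammer_succ_eval, ← ih, risingCoeff, Finset.prod_range_succ, ← risingCoeff,
      Nat.factorial_succ]
    push_cast
    field_simp

lemma risingCoeff_eq_choose (j : ℕ) (s : ℂ) : risingCoeff j s = Ring.choose (s + j - 1) j := by
  have h := Ring.factorial_nsmul_multichoose_eq_ascPochhammer s j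
  rw [Polynomial.ascPochhammer_smeval_eq_eval, ← factorial_mul_risingCoeff, Ring.multichoose_eq,
    nsmul_eq_mul] at h
  exact (mul_left_cancel₀ (by exact_mod_cast j.factorial_ne_zero) h).symm

lemma hasSum_risingCoeff (s : ℂ) {x : ℂ} (hx : ‖x‖ < 1) :
    HasSum (fun j => risingCoeff j s * x ^ j) ((1 - x) ^ (-s)) := by
  have h := (Complex.one_div_one_sub_cpow_hasFPowerSeriesOnBall_zero s).hasSum (y := x) (by
    rw [← ENNReal.ofReal_one, Metric.eball_ofReal]; simpa using hx)
  simp only [zero_add, one_div, ← Complex.cpow_neg] at h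
  refine h.congr_fun fun j => ?_
  simp [FormalMultilinearSeries.ofScalars, risingCoeff_eq_choose]

lemma risingCoeff_nonneg {R : ℝ} (hR : 0 ≤ R) (j : ℕ) : 0 ≤ risingCoeff j R :=
  Finset.prod_nonneg fun i _ => by positivity

lemma norm_risingCoeff_le {s : ℂ} {R : ℝ} (h : ‖s‖ ≤ R) (j : ℕ) :
    ‖risingCoeff j s‖ ≤ risingCoeff j R := by
  rw [risingCoeff, norm_prod]
  refine Finset.prod_le_prod (fun _ _ => norm_nonneg _) fun i _ => ?_
  rw [norm_div]
  have : ‖(i : ℂ) + 1‖ = i + 1 := by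
    have := Complex.norm_natCast (i + 1)
    push_cast at this
    exact this
  rw [this]
  gcongr
  exact (norm_add_le _ _).trans (by simpa using h)

lemma risingCoeff_ofReal (j : ℕ) (R : ℝ) : ((risingCoeff j R : ℝ) : ℂ) = risingCoeff j (R : ℂ) := by
  simp [risingCoeff]

lemma summable_risingCoeff (R : ℝ) {x : ℝ} (hx : |x| < 1) :
    Summable fun j => risingCoeff j R * x ^ j := by
  have := (hasSum_risingCoeff (R : ℂ) (x := (x : ℂ)) (by simpa using hx)).summable
  rw [← Complex.summable_ofReal]
  refine this.congr fun j => ?_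
  push_cast
  rw [risingCoeff_ofReal]

/-- The linear factor comes from |w + j| in the termwise bound for the zeta tails. Absorbing it
raises the parameter by one, so the series still converges at 1/2. -/
lemma add_mul_risingCoeff (R : ℝ) (j : ℕ) :
    (R + j) * risingCoeff j R = R * risingCoeff j (R + 1) := by
  induction j with
  | zero => simp [risingCoeff]
  | succ j ih =>
    have e : ∀ r : ℝ, risingCoeff (j + 1) r = risingCoeff j r * ((r + j) / (j + 1)) := fun r => by
      rw [risingCoeff, Finset.prod_range_succ, ← risingCoeff]
    rw [e, e]
    push_cast
    linear_combination ((R + 1 + j) / (j + 1)) * ih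

lemma summable_mul_risingCoeff (R : ℝ) {x : ℝ} (hx : |x| < 1) :
    Summable fun j : ℕ => (R + j) * risingCoeff j R * x ^ j := by
  refine ((summable_risingCoeff (R + 1) hx).mul_left R).congr fun j => ?_
  rw [add_mul_risingCoeff]; ring

lemma differentiable_risingCoeff (j : ℕ) : Differentiable ℂ (risingCoeff j : ℂ → ℂ) := by
  have : (risingCoeff j : ℂ → ℂ) = fun s => ∏ i ∈ Finset.range j, (s + i) / ((i : ℂ) + 1) := rfl
  rw [this]
  fun_prop

/-- The pairs `(s, w)` with `Re w > 0` and `w ≠ 1`. -/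
def tailDomain : Set (ℂ × ℂ) := {q | 0 < q.2.re ∧ q.2 ≠ 1}

lemma isOpen_tailDomain : IsOpen tailDomain := isOpen_re_pos_ne_one.preimage continuous_snd

lemma re_add_natCast_pos {w : ℂ} (hw : 0 < w.re) (j : ℕ) : 0 < (w + j).re := by
  have : (0 : ℝ) ≤ j := by positivity
  simp; linarith

lemma add_natCast_ne_one {w : ℂ} (hw : 0 < w.re) (hw1 : w ≠ 1) (j : ℕ) : w + j ≠ 1 := by
  rcases j.eq_zero_or_pos with rfl | hj
  · simpa using hw1
  · intro h
    have h1 := congrArg Complex.re h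
    have : (1 : ℝ) ≤ j := by exact_mod_cast hj
    simp at h1
    linarith

lemma min_le_norm_add_natCast_sub_one (w : ℂ) (j : ℕ) :
    min ‖w - 1‖ w.re ≤ ‖w + j - 1‖ := by
  rcases j.eq_zero_or_pos with rfl | hj
  · simp
  · have : (1 : ℝ) ≤ j := by exact_mod_cast hj
    refine (min_le_right _ _).trans (le_trans ?_ (Complex.re_le_norm _))
    simp
    linarith

lemma norm_polePart_term_le {x : ℝ} (hx0 : 0 ≤ x) (hx : x ≤ 1 / 2) {q : ℂ × ℂ} {R m : ℝ}
    (hR : ‖q.1‖ ≤ R) (hm : 0 < m) (j : ℕ) (hq : m ≤ ‖q.2 + j - 1‖) :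
    ‖risingCoeff j q.1 * (x : ℂ) ^ j / (q.2 + j - 1)‖ ≤
      risingCoeff j R * (1 / 2) ^ j * (1 / m) := by
  have hR0 : 0 ≤ R := (norm_nonneg _).trans hR
  have := risingCoeff_nonneg hR0 j
  rw [norm_div, norm_mul, norm_pow, Complex.norm_real, Real.norm_of_nonneg hx0, div_eq_mul_one_div]
  gcongr
  exact norm_risingCoeff_le hR j

lemma abs_half_lt_one : |(1 / 2 : ℝ)| < 1 := by rw [abs_of_pos] <;> norm_num

lemma summable_polePart {x : ℝ} (hx0 : 0 ≤ x) (hx : x ≤ 1 / 2) {q : ℂ × ℂ} (hq : q ∈ tailDomain) :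
    Summable fun j : ℕ => risingCoeff j q.1 * (x : ℂ) ^ j / (q.2 + j - 1) :=
  Summable.of_norm_bounded ((summable_risingCoeff ‖q.1‖ abs_half_lt_one).mul_right _) fun j =>
    norm_polePart_term_le hx0 hx le_rfl
      (lt_min (norm_pos_iff.2 (sub_ne_zero.2 hq.2)) hq.1) j (min_le_norm_add_natCast_sub_one q.2 j)

lemma norm_polePart_le {x : ℝ} (hx0 : 0 ≤ x) (hx : x ≤ 1 / 2) {q : ℂ × ℂ} (hq : q.2.im ≠ 0) :
    ‖polePart x q‖ ≤ (∑' j, risingCoeff j ‖q.1‖ * (1 / 2) ^ j) * (1 / |q.2.im|) := by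
  rw [← tsum_mul_right]
  refine tsum_of_norm_bounded ((summable_risingCoeff ‖q.1‖ abs_half_lt_one).mul_right _).hasSum
    fun j => norm_polePart_term_le hx0 hx le_rfl (abs_pos.2 hq) j ?_
  simpa using Complex.abs_im_le_norm (q.2 + j - 1)

lemma differentiableOn_polePart {x : ℝ} (hx0 : 0 ≤ x) (hx : x ≤ 1 / 2) :
    DifferentiableOn ℂ (polePart x) tailDomain := by
  refine differentiableOn_tsum_of_locally_summable isOpen_tailDomain ?_ ?_
  · intro j q hq
    have h1 : DifferentiableAt ℂ (fun q : ℂ × ℂ => risingCoeff j q.1) q :=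
      (differentiable_risingCoeff j _).comp q differentiableAt_fst
    have h2 : q.2 + j - 1 ≠ 0 := sub_ne_zero.2 (add_natCast_ne_one hq.1 hq.2 j)
    have h3 : DifferentiableAt ℂ (fun q : ℂ × ℂ => (q.2 + j - 1)⁻¹) q :=
      DifferentiableAt.inv (by fun_prop) h2
    simp only [div_eq_mul_inv]
    exact ((h1.mul_const _).mul h3).differentiableWithinAt
  · intro q hq
    set m := min ‖q.2 - 1‖ q.2.re with hm
    have hm0 : 0 < m := lt_min (norm_pos_iff.2 (sub_ne_zero.2 hq.2)) hq.1
    refine ⟨fun j => risingCoeff j (‖q.1‖ + 1) * (1 / 2) ^ j * (1 / (m / 2)),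
      (summable_risingCoeff _ abs_half_lt_one).mul_right _, ?_⟩
    have c1 : Continuous fun q : ℂ × ℂ => ‖q.1‖ := by fun_prop
    have c2 : Continuous fun q : ℂ × ℂ => min ‖q.2 - 1‖ q.2.re := by fun_prop
    filter_upwards [isOpen_tailDomain.mem_nhds hq,
      c1.continuousAt.eventually (gt_mem_nhds (lt_add_one ‖q.1‖)),
      c2.continuousAt.eventually (lt_mem_nhds (half_lt_self hm0))] with z hz hz1 hz2 j
    exact norm_polePart_term_le hx0 hx hz1.le (half_pos hm0) j
      (hz2.le.trans (min_le_norm_add_natCast_sub_one z.2 j))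

lemma natCast_pow_mul_rpow_le {n K : ℕ} (hn : 0 < n) (hK : 2 * n ≤ K) (a : ℝ) (j : ℕ) :
    (n : ℝ) ^ j * (K : ℝ) ^ (-(a + j)) ≤ (1 / 2) ^ j * (K : ℝ) ^ (-a) := by
  have hK0 : (0 : ℝ) < K := by exact_mod_cast (by omega : 0 < K)
  have h1 : (n : ℝ) / K ≤ 1 / 2 := by
    rw [div_le_div_iff₀ hK0 (by norm_num)]
    have : (2 : ℝ) * n ≤ K := by exact_mod_cast hK
    linarith
  rw [neg_add, Real.rpow_add hK0, Real.rpow_neg hK0.le (j : ℝ), Real.rpow_natCast]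
  calc (n : ℝ) ^ j * ((K : ℝ) ^ (-a) * ((K : ℝ) ^ j)⁻¹) = ((n : ℝ) / K) ^ j * (K : ℝ) ^ (-a) := by
        rw [div_pow]; ring
    _ ≤ _ := by gcongr

lemma norm_tailPart_term_le {n K : ℕ} (hn : 0 < n) (hK : 2 * n ≤ K) {q : ℂ × ℂ}
    (hq : q ∈ tailDomain) {R : ℝ} (hR1 : ‖q.1‖ ≤ R) (hR2 : ‖q.2‖ ≤ R) (j : ℕ) :
    ‖risingCoeff j q.1 * (n : ℂ) ^ j * zetaTail K (q.2 + j)‖ ≤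
      (R + j) * risingCoeff j R * (1 / 2) ^ j * ((1 + 1 / q.2.re) * (K : ℝ) ^ (-q.2.re)) := by
  have hR0 : 0 ≤ R := (norm_nonneg _).trans hR1
  have hr := risingCoeff_nonneg hR0 j
  have hK0 : 0 < K := by omega
  have hre := re_add_natCast_pos hq.1 j
  have h0 := hq.1
  have hre' : (q.2 + j).re = q.2.re + j := by simp
  have h1 := norm_zetaTail_le hK0 (add_natCast_ne_one hq.1 hq.2 j) hre
  have h2 : ‖q.2 + j‖ ≤ R + j := (norm_add_le _ _).trans (by simpa using hR2)
  have h3 : 1 + 1 / (q.2 + j).re ≤ 1 + 1 / q.2.re := by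
    have : q.2.re ≤ (q.2 + j).re := by rw [hre']; simp
    gcongr
  rw [norm_mul, norm_mul, norm_pow, Complex.norm_natCast]
  have h4 := natCast_pow_mul_rpow_le hn hK q.2.re j
  calc _ ≤ risingCoeff j R * (n : ℝ) ^ j *
        ((R + j) * (1 + 1 / q.2.re) * (K : ℝ) ^ (-(q.2.re + j))) := by
        gcongr
        · exact norm_risingCoeff_le hR1 j
        · refine h1.trans ?_
          rw [hre'] at h3 ⊢
          gcongr
    _ = (R + j) * risingCoeff j R * (1 + 1 / q.2.re) * ((n : ℝ) ^ j * (K : ℝ) ^ (-(q.2.re + j))) := by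
        ring
    _ ≤ (R + j) * risingCoeff j R * (1 + 1 / q.2.re) * ((1 / 2) ^ j * (K : ℝ) ^ (-q.2.re)) := by
        gcongr
    _ = _ := by ring

lemma norm_tailPart_le_of_le {n K : ℕ} (hn : 0 < n) (hK : 2 * n ≤ K) {q : ℂ × ℂ}
    (hq : q ∈ tailDomain) {R : ℝ} (hR1 : ‖q.1‖ ≤ R) (hR2 : ‖q.2‖ ≤ R) :
    ‖tailPart n K q‖ ≤ (∑' j : ℕ, (R + j) * risingCoeff j R * (1 / 2) ^ j) *
      ((1 + 1 / q.2.re) * (K : ℝ) ^ (-q.2.re)) := by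
  rw [← tsum_mul_right]
  exact tsum_of_norm_bounded ((summable_mul_risingCoeff R abs_half_lt_one).mul_right _).hasSum
    fun j => norm_tailPart_term_le hn hK hq hR1 hR2 j

lemma differentiableOn_tailPart {n K : ℕ} (hn : 0 < n) (hK : 2 * n ≤ K) :
    DifferentiableOn ℂ (tailPart n K) tailDomain := by
  have hK0 : 0 < K := by omega
  refine differentiableOn_tsum_of_locally_summable isOpen_tailDomain ?_ ?_
  · intro j
    have h1 : DifferentiableOn ℂ (fun q : ℂ × ℂ => risingCoeff j q.1) tailDomain :=
      ((differentiable_risingCoeff j).comp differentiable_fst).differentiableOn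
    have h2 : DifferentiableOn ℂ (fun q : ℂ × ℂ => zetaTail K (q.2 + j)) tailDomain :=
      (differentiableOn_zetaTail hK0).comp (by fun_prop)
        fun q hq => ⟨re_add_natCast_pos hq.1 j, add_natCast_ne_one hq.1 hq.2 j⟩
    exact (h1.mul_const _).mul h2
  · intro q hq
    set R := ‖q.1‖ + ‖q.2‖ + 1
    have hpos : 0 < q.2.re := hq.1
    refine ⟨fun j => (R + j) * risingCoeff j R * (1 / 2) ^ j * (1 + 1 / (q.2.re / 2)),
      (summable_mul_risingCoeff R abs_half_lt_one).mul_right _, ?_⟩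
    have c1 : Continuous fun q : ℂ × ℂ => ‖q.1‖ := by fun_prop
    have c2 : Continuous fun q : ℂ × ℂ => ‖q.2‖ := by fun_prop
    have c3 : Continuous fun q : ℂ × ℂ => q.2.re := by fun_prop
    filter_upwards [isOpen_tailDomain.mem_nhds hq,
      c1.continuousAt.eventually (gt_mem_nhds (show ‖q.1‖ < R by
        simp only [R]; linarith [norm_nonneg q.2])),
      c2.continuousAt.eventually (gt_mem_nhds (show ‖q.2‖ < R by
        simp only [R]; linarith [norm_nonneg q.1])),
      c3.continuousAt.eventually (lt_mem_nhds (half_lt_self hpos))] with z hz hz1 hz2 hz3 j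
    refine (norm_tailPart_term_le hn hK hz hz1.le hz2.le j).trans ?_
    have hR0 : 0 ≤ R := by positivity
    have := risingCoeff_nonneg hR0 j
    have hK1 : (1 : ℝ) ≤ K := by exact_mod_cast hK0
    have h5 : (K : ℝ) ^ (-z.2.re) ≤ 1 := Real.rpow_le_one_of_one_le_of_nonpos hK1 (by linarith [hz.1])
    have h6 : 1 + 1 / z.2.re ≤ 1 + 1 / (q.2.re / 2) := by gcongr
    have h7 : 0 ≤ 1 / z.2.re := by have := hz.1; positivity
    have h8 : (1 + 1 / z.2.re) * (K : ℝ) ^ (-z.2.re) ≤ 1 + 1 / (q.2.re / 2) := by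
      refine le_trans ?_ h6
      exact mul_le_of_le_one_right (by linarith) h5
    gcongr

/-- The bound for `tailPart` in the range `K ≫ |w|`, uniform in `w`. -/
lemma exists_norm_tailPart_le (s : ℂ) : ∃ C ≥ (1 : ℝ), ∀ a₀ > (0 : ℝ), ∃ A ≥ (0 : ℝ),
    ∀ (w : ℂ) (n K : ℕ), 0 < n →
    2 * n ≤ K → a₀ ≤ w.re → 1 ≤ |w.im| → C * ‖w‖ ≤ K →
    ‖tailPart n K (s, w)‖ ≤ A * (K : ℝ) ^ (-w.re) := by
  obtain ⟨C, hC, A, hA, h⟩ := exists_norm_zetaTail_le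
  -- Doubling `C` ensures that whenever the uniform bound is unavailable at w + j, the index
  -- satisfies j ≥ |w|.
  refine ⟨2 * C, by linarith, fun a₀ ha₀ => ⟨(∑' j : ℕ, (‖s‖ + 1 + j) * risingCoeff j (‖s‖ + 1) *
    (1 / 2) ^ j) * ((A + 2) * (1 + 1 / a₀)), ?_, ?_⟩⟩
  · refine mul_nonneg (tsum_nonneg fun j => ?_) (by positivity)
    have := risingCoeff_nonneg (show 0 ≤ ‖s‖ + 1 by positivity) j
    positivity
  intro w n K hn hK ha him hCK
  set R := ‖s‖ + 1 with hR
  have hre : 0 < w.re := by linarith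
  have hK0 : 0 < K := by omega
  have hKp : (0 : ℝ) < K := by exact_mod_cast hK0
  have hw1 : w ≠ 1 := by rintro rfl; norm_num at him
  rw [tailPart, mul_assoc, ← tsum_mul_right]
  refine tsum_of_norm_bounded ((summable_mul_risingCoeff R abs_half_lt_one).mul_right _).hasSum
    fun j => ?_
  have hR0 : 0 ≤ R := by positivity
  have hr := risingCoeff_nonneg hR0 j
  have hrej := re_add_natCast_pos hre j
  have hre' : (w + j).re = w.re + j := by simp
  have hinv : 1 + 1 / (w + j).re ≤ 1 + 1 / a₀ := by
    have : a₀ ≤ (w + j).re := by rw [hre']; linarith [(Nat.cast_nonneg j : (0 : ℝ) ≤ j)]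
    gcongr
  have hz : ‖zetaTail K (w + j)‖ ≤ (R + j) * ((A + 2) * (1 + 1 / a₀)) * (K : ℝ) ^ (-(w.re + j)) := by
    have hj0 : (0 : ℝ) ≤ j := by positivity
    have hRj : 1 ≤ R + j := by rw [hR]; linarith [norm_nonneg s]
    -- Where the uniform bound fails, |w + j| ≤ 2j, so the factor lost in the termwise bound depends
    -- on `j` only and is paid for by the geometric decay.
    by_cases hj : C * ‖w + j‖ ≤ K
    · refine (h (w + j) K hrej (by simpa using him) hj).trans ?_
      rw [hre'] at hinv ⊢
      refine mul_le_mul_of_nonneg_right ?_ (by positivity)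
      calc A * (1 + 1 / (w.re + j)) ≤ 1 * ((A + 2) * (1 + 1 / a₀)) := by
            rw [one_mul]; gcongr; linarith
        _ ≤ _ := by gcongr
    · refine (norm_zetaTail_le hK0 (add_natCast_ne_one hre hw1 j) hrej).trans ?_
      have h1 : ‖w + j‖ ≤ 2 * j := by
        have h2 : ‖w + j‖ ≤ ‖w‖ + j := (norm_add_le _ _).trans (by simp)
        push Not at hj
        have : ‖w‖ ≤ j := by nlinarith
        linarith
      rw [hre'] at hinv ⊢
      refine mul_le_mul_of_nonneg_right ?_ (by positivity)
      calc ‖w + j‖ * (1 + 1 / (w.re + j)) ≤ (2 * j) * (1 + 1 / a₀) := by gcongr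
        _ ≤ (R + j) * (A + 2) * (1 + 1 / a₀) := by
            refine mul_le_mul_of_nonneg_right ?_ (by positivity)
            nlinarith [mul_nonneg hA (by linarith : 0 ≤ R + j)]
        _ = _ := by ring
  rw [norm_mul, norm_mul, norm_pow, Complex.norm_natCast]
  have h4 := natCast_pow_mul_rpow_le hn hK w.re j
  have hrs : ‖risingCoeff j s‖ ≤ risingCoeff j R := norm_risingCoeff_le (by rw [hR]; linarith) j
  simp only
  calc _ ≤ risingCoeff j R * (n : ℝ) ^ j *
        ((R + j) * ((A + 2) * (1 + 1 / a₀)) * (K : ℝ) ^ (-(w.re + j))) := by gcongr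
    _ = (R + j) * risingCoeff j R * ((A + 2) * (1 + 1 / a₀)) *
          ((n : ℝ) ^ j * (K : ℝ) ^ (-(w.re + j))) := by ring
    _ ≤ (R + j) * risingCoeff j R * ((A + 2) * (1 + 1 / a₀)) *
          ((1 / 2) ^ j * (K : ℝ) ^ (-w.re)) := by gcongr
    _ = _ := by ring

/-! ### The analytic continuation of the Apostol-Vu series. -/

noncomputable section

/-- The coefficient of `k^{-s₃}` in the Apostol-Vu series. -/
def avCoeff (s₁ s₂ : ℂ) (k : ℕ) : ℂ :=
  ∑ m ∈ (Finset.Ico 1 k).filter (fun m => k < 2 * m),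
    1 / ((m : ℂ) ^ s₁ * ((k : ℂ) - (m : ℂ)) ^ s₂)

/-- The sum of the first terms of the Apostol-Vu series, as a Dirichlet series in `s₃`. -/
def avPartial (M : ℕ) (p : ℂ × ℂ × ℂ) : ℂ :=
  ∑ k ∈ Finset.range (2 * M + 1), avCoeff p.1 p.2.1 k * (1 / (k : ℂ) ^ p.2.2)

/-- The continuation of the terms of the Apostol-Vu series that `avPartial` omits. -/
def avRest (M : ℕ) (p : ℂ × ℂ × ℂ) : ℂ :=
  (∑ n ∈ Finset.range M, ((n + 1 : ℕ) : ℂ) ^ (-p.2.1) * (((2 * M : ℕ) : ℂ) ^ (1 - (p.1 + p.2.2)) *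
      polePart (((n + 1 : ℕ) : ℝ) / ((2 * M : ℕ) : ℝ)) (p.1, p.1 + p.2.2))) +
  (2 : ℂ) ^ (1 - (p.1 + p.2.2)) * polePart (1 / 2) (p.1, p.1 + p.2.2) *
    ((M : ℂ) ^ (1 - (p.1 + p.2.1 + p.2.2 - 1)) / (p.1 + p.2.1 + p.2.2 - 1 - 1) +
      zetaTail M (p.1 + p.2.1 + p.2.2 - 1)) +
  ∑' n : ℕ, ((n + 1 : ℕ) : ℂ) ^ (-p.2.1) *
    tailPart (n + 1) (2 * max (n + 1) M) (p.1, p.1 + p.2.2)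

end

lemma summable_natCast_cpow_neg {K : ℕ} (hK : 0 < K) {w : ℂ} (hw : 1 < w.re) :
    Summable fun i : ℕ => ((K + i : ℕ) : ℂ) ^ (-w) := by
  refine Summable.of_norm ((summable_rpow_add (a := w.re - 1) (by linarith) K).congr fun i => ?_)
  rw [norm_natCast_cpow_neg (by omega)]
  congr 1; ring

lemma hasSum_sub_cpow_mul_cpow {n k : ℕ} (hk : 2 * n < k) (s w : ℂ) :
    HasSum (fun j : ℕ => risingCoeff j s * (n : ℂ) ^ j * (k : ℂ) ^ (-(w + j)))
      (((k : ℂ) - n) ^ (-s) * (k : ℂ) ^ (-(w - s))) := by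
  have hk0 : (0 : ℝ) < k := by exact_mod_cast (by omega : 0 < k)
  have hkc : (k : ℂ) ≠ 0 := by exact_mod_cast hk0.ne'
  have hx : (n : ℝ) / k < 1 := by
    rw [div_lt_one hk0]; exact_mod_cast (by omega : n < k)
  have h := (hasSum_risingCoeff s (x := ((n / k : ℝ) : ℂ)) (by
    rw [Complex.norm_real, Real.norm_of_nonneg (by positivity)]; exact hx)).mul_left ((k : ℂ) ^ (-w))
  have e : ((k : ℂ) - n) ^ (-s) * (k : ℂ) ^ (-(w - s))
      = (k : ℂ) ^ (-w) * (1 - ((n / k : ℝ) : ℂ)) ^ (-s) := by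
    have h1 : (k : ℂ) - n = ((k : ℝ) : ℂ) * ((1 - n / k : ℝ) : ℂ) := by
      push_cast; field_simp
    rw [h1, Complex.mul_cpow_ofReal_nonneg hk0.le (by linarith)]
    have h2 : -w = -s + -(w - s) := by ring
    rw [h2, Complex.cpow_add _ _ hkc]
    push_cast
    ring
  rw [e]
  refine h.congr_fun fun j => ?_
  rw [neg_add, Complex.cpow_add _ _ hkc, Complex.cpow_neg _ (j : ℂ), Complex.cpow_natCast]
  push_cast
  rw [div_pow]
  ring

/-- Since n/k < 1/2 for k > K, the binomial double series converges absolutely and may be summed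
over `k` first. Each zeta tail then splits into its explicit part, collected in `polePart`, and its
defect, collected in `tailPart`. -/
lemma tsum_sub_cpow_mul_cpow {n K : ℕ} (hn : 0 < n) (hK : 2 * n ≤ K) {s w : ℂ} (hw : 1 < w.re) :
    ∑' i : ℕ, (((K + 1 + i : ℕ) : ℂ) - n) ^ (-s) * ((K + 1 + i : ℕ) : ℂ) ^ (-(w - s)) =
      (K : ℂ) ^ (1 - w) * polePart ((n : ℝ) / (K : ℝ)) (s, w) + tailPart n K (s, w) := by
  have hK0 : 0 < K := by omega
  have hKc : (K : ℂ) ≠ 0 := by exact_mod_cast hK0.ne'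
  have hw0 : 0 < w.re := by linarith
  have hw1 : w ≠ 1 := by rintro rfl; simp at hw
  have hq : (s, w) ∈ tailDomain := ⟨hw0, hw1⟩
  have e1 : ∀ i : ℕ, (((K + 1 + i : ℕ) : ℂ) - n) ^ (-s) * ((K + 1 + i : ℕ) : ℂ) ^ (-(w - s)) =
      ∑' j : ℕ, risingCoeff j s * (n : ℂ) ^ j * ((K + 1 + i : ℕ) : ℂ) ^ (-(w + j)) := fun i =>
    (hasSum_sub_cpow_mul_cpow (by omega) s w).tsum_eq.symm
  have hsum : Summable (Function.uncurry fun i j : ℕ =>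
      risingCoeff j s * (n : ℂ) ^ j * ((K + 1 + i : ℕ) : ℂ) ^ (-(w + j))) := by
    have h1 : Summable fun i : ℕ => ((K + 1 + i : ℕ) : ℝ) ^ (-(w.re - 1) - 1) :=
      summable_rpow_add (by linarith) (K + 1)
    have h2 := summable_risingCoeff ‖s‖ abs_half_lt_one
    have h3 := h1.mul_of_nonneg h2 (fun i => by positivity)
      (fun j => mul_nonneg (risingCoeff_nonneg (norm_nonneg s) j) (by positivity))
    refine Summable.of_norm_bounded h3 fun x => ?_
    obtain ⟨i, j⟩ := x
    simp only [Function.uncurry]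
    have hb := norm_risingCoeff_le (le_refl ‖s‖) j
    have hb0 := risingCoeff_nonneg (norm_nonneg s) j
    rw [norm_mul, norm_mul, norm_pow, Complex.norm_natCast, norm_natCast_cpow_neg (by omega)]
    have h4 := natCast_pow_mul_rpow_le (K := K + 1 + i) hn (by omega) w.re j
    have e : -(w.re - 1) - 1 = -w.re := by ring
    rw [e, Complex.add_re, Complex.natCast_re, mul_assoc]
    calc _ ≤ risingCoeff j ‖s‖ * ((1 / 2) ^ j * ((K + 1 + i : ℕ) : ℝ) ^ (-w.re)) := by gcongr
      _ = _ := by ring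
  simp_rw [e1]
  rw [← Summable.tsum_comm hsum]
  have e2 : ∀ j : ℕ, ∑' i : ℕ, risingCoeff j s * (n : ℂ) ^ j * ((K + 1 + i : ℕ) : ℂ) ^ (-(w + j)) =
      (K : ℂ) ^ (1 - w) * (risingCoeff j s * (((n : ℝ) / (K : ℝ) : ℝ) : ℂ) ^ j / (w + j - 1)) +
        risingCoeff j s * (n : ℂ) ^ j * zetaTail K (w + j) := by
    intro j
    rw [tsum_mul_left, tsum_cpow_eq hK0 (by simp; linarith [(Nat.cast_nonneg j : (0 : ℝ) ≤ j)]),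
      mul_add]
    congr 1
    have : 1 - (w + j) = 1 - w + -(j : ℂ) := by ring
    rw [this, Complex.cpow_add _ _ hKc, Complex.cpow_neg _ (j : ℂ), Complex.cpow_natCast]
    push_cast
    rw [div_pow]
    ring
  simp_rw [e2]
  have hx : (n : ℝ) / K ≤ 1 / 2 := by
    rw [div_le_div_iff₀ (by exact_mod_cast hK0) (by norm_num)]
    have : (2 : ℝ) * n ≤ K := by exact_mod_cast hK
    linarith
  have s1 := (summable_polePart (x := (n : ℝ) / K) (by positivity) hx hq).mul_left ((K : ℂ) ^ (1 - w))
  have s2 : Summable fun j : ℕ => risingCoeff j s * (n : ℂ) ^ j * zetaTail K (w + j) :=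
    Summable.of_norm_bounded ((summable_mul_risingCoeff (‖s‖ + ‖w‖) abs_half_lt_one).mul_right _)
      fun j => norm_tailPart_term_le hn hK hq (by simp) (by simp) j
  rw [s1.tsum_add s2, tsum_mul_left]
  rfl

lemma mapsTo_tailDomain : Set.MapsTo (fun p : ℂ × ℂ × ℂ => (p.1, p.1 + p.2.2)) (avDomain 1)
    tailDomain := fun p hp => by
  obtain ⟨h1, -, h2, -⟩ := mem_avDomain_one.1 hp
  exact ⟨h1, h2⟩

lemma differentiable_natCast_cpow {k : ℕ} (hk : 0 < k) {f : ℂ × ℂ × ℂ → ℂ} (hf : Differentiable ℂ f) :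
    Differentiable ℂ fun p => (k : ℂ) ^ f p := fun p =>
  (hf p).const_cpow (Or.inl (by exact_mod_cast hk.ne'))

lemma differentiable_avPartial (M : ℕ) : Differentiable ℂ (avPartial M) := by
  unfold avPartial
  refine Differentiable.fun_sum fun k _ => ?_
  simp only [avCoeff, Finset.sum_mul]
  refine Differentiable.fun_sum fun m hm => ?_
  simp only [Finset.mem_filter, Finset.mem_Ico] at hm
  have hk : 0 < k := by omega
  have e : (k : ℂ) - m = ((k - m : ℕ) : ℂ) := by rw [Nat.cast_sub (by omega)]
  have h1 := differentiable_natCast_cpow (k := m) (by omega) (f := fun p => -p.1) (by fun_prop)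
  have h2 := differentiable_natCast_cpow (k := k - m) (by omega) (f := fun p => -p.2.1) (by fun_prop)
  have h3 := differentiable_natCast_cpow hk (f := fun p => -p.2.2) (by fun_prop)
  rw [e]
  simp only [one_div, mul_inv, ← Complex.cpow_neg]
  exact (h1.mul h2).mul h3

lemma norm_avRest_term_le {M n : ℕ} {p : ℂ × ℂ × ℂ}
    (hp : (p.1, p.1 + p.2.2) ∈ tailDomain) {R : ℝ} (hR1 : ‖p.1‖ ≤ R) (hR2 : ‖p.1 + p.2.2‖ ≤ R) :
    ‖((n + 1 : ℕ) : ℂ) ^ (-p.2.1) * tailPart (n + 1) (2 * max (n + 1) M) (p.1, p.1 + p.2.2)‖ ≤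
      (∑' j : ℕ, (R + j) * risingCoeff j R * (1 / 2) ^ j) * (1 + 1 / (p.1 + p.2.2).re) *
        ((1 + n : ℕ) : ℝ) ^ (-(p.1 + p.2.1 + p.2.2).re) := by
  have h0 : 0 < (p.1 + p.2.2).re := hp.1
  have h := norm_tailPart_le_of_le (n := n + 1) (K := 2 * max (n + 1) M) (by omega) (by omega) hp
    hR1 hR2
  have hn : (0 : ℝ) < ((n + 1 : ℕ) : ℝ) := by positivity
  have hR0 : 0 ≤ R := (norm_nonneg _).trans hR1
  have hA : 0 ≤ ∑' j : ℕ, (R + j) * risingCoeff j R * (1 / 2) ^ j := tsum_nonneg fun j => by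
    have := risingCoeff_nonneg hR0 j
    positivity
  rw [norm_mul, norm_natCast_cpow_neg (by omega)]
  have hK : ((2 * max (n + 1) M : ℕ) : ℝ) ^ (-(p.1 + p.2.2).re) ≤
      ((n + 1 : ℕ) : ℝ) ^ (-(p.1 + p.2.2).re) :=
    Real.rpow_le_rpow_of_nonpos hn (by exact_mod_cast (by omega)) (by linarith)
  have e : -(p.1 + p.2.1 + p.2.2).re = -p.2.1.re + -(p.1 + p.2.2).re := by simp; ring
  rw [e, add_comm 1 n, Real.rpow_add hn]
  calc _ ≤ ((n + 1 : ℕ) : ℝ) ^ (-p.2.1.re) * ((∑' j : ℕ, (R + j) * risingCoeff j R * (1 / 2) ^ j) *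
      ((1 + 1 / (p.1 + p.2.2).re) * ((n + 1 : ℕ) : ℝ) ^ (-(p.1 + p.2.2).re))) := by
        gcongr
        refine h.trans ?_
        gcongr
    _ = _ := by ring

lemma differentiableOn_avRest {M : ℕ} (hM : 0 < M) : DifferentiableOn ℂ (avRest M) (avDomain 1) := by
  have hmap : Differentiable ℂ fun p : ℂ × ℂ × ℂ => (p.1, p.1 + p.2.2) := by fun_prop
  have hpole : ∀ x : ℝ, 0 ≤ x → x ≤ 1 / 2 → DifferentiableOn ℂ
      (fun p : ℂ × ℂ × ℂ => polePart x (p.1, p.1 + p.2.2)) (avDomain 1) := fun x h0 h1 =>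
    (differentiableOn_polePart h0 h1).comp hmap.differentiableOn mapsTo_tailDomain
  unfold avRest
  refine DifferentiableOn.add (DifferentiableOn.add ?_ ?_) ?_
  · refine DifferentiableOn.fun_sum fun n hn => ?_
    have hn' : n + 1 ≤ M := Finset.mem_range.1 hn
    have hM' : (0 : ℝ) < ((2 * M : ℕ) : ℝ) := by exact_mod_cast (by omega : 0 < 2 * M)
    have h3 := hpole (((n + 1 : ℕ) : ℝ) / ((2 * M : ℕ) : ℝ)) (by positivity) (by
      rw [div_le_div_iff₀ hM' (by norm_num)]
      exact_mod_cast (by omega : (n + 1) * 2 ≤ 1 * (2 * M)))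
    exact (differentiable_natCast_cpow (by omega) (by fun_prop)).differentiableOn.mul
      ((differentiable_natCast_cpow (by omega) (by fun_prop)).differentiableOn.mul h3)
  · have h2 : Differentiable ℂ fun p : ℂ × ℂ × ℂ => (2 : ℂ) ^ (1 - (p.1 + p.2.2)) := by
      have := differentiable_natCast_cpow (k := 2) (by norm_num)
        (f := fun p : ℂ × ℂ × ℂ => 1 - (p.1 + p.2.2)) (by fun_prop)
      exact_mod_cast this
    have h3 := hpole (1 / 2) (by norm_num) le_rfl
    have h4 : DifferentiableOn ℂ (fun p : ℂ × ℂ × ℂ => zetaTail M (p.1 + p.2.1 + p.2.2 - 1))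
        (avDomain 1) := by
      refine (differentiableOn_zetaTail hM).comp (by fun_prop) fun p hp => ?_
      obtain ⟨-, h1, -, h2⟩ := mem_avDomain_one.1 hp
      refine ⟨?_, fun h => h2 ?_⟩
      · simp at h1 ⊢; linarith
      · linear_combination h
    have h5 : DifferentiableOn ℂ (fun p : ℂ × ℂ × ℂ => (p.1 + p.2.1 + p.2.2 - 1 - 1)⁻¹)
        (avDomain 1) := by
      refine DifferentiableOn.inv (by fun_prop) fun p hp h => ?_
      obtain ⟨-, -, -, h2⟩ := mem_avDomain_one.1 hp
      exact h2 (by linear_combination h)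
    simp only [div_eq_mul_inv] at h3 ⊢
    exact (h2.differentiableOn.mul h3).mul
      (((differentiable_natCast_cpow hM (by fun_prop)).differentiableOn.mul h5).add h4)
  · refine differentiableOn_tsum_of_locally_summable isOpen_avDomain_one ?_ ?_
    · intro n
      exact (differentiable_natCast_cpow (by omega) (by fun_prop)).differentiableOn.mul
        ((differentiableOn_tailPart (by omega) (by omega)).comp hmap.differentiableOn
          mapsTo_tailDomain)
    · intro p hp
      obtain ⟨ha, hb, -, -⟩ := mem_avDomain_one.1 hp
      set R := ‖p.1‖ + ‖p.1 + p.2.2‖ + 1 with hR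
      set b := (p.1 + p.2.1 + p.2.2).re with hbdef
      have hR0 : 0 ≤ R := by positivity
      refine ⟨fun n => (∑' j : ℕ, (R + j) * risingCoeff j R * (1 / 2) ^ j) *
        (1 + 1 / ((p.1 + p.2.2).re / 2)) * ((1 + n : ℕ) : ℝ) ^ (-((b - 1) / 2) - 1),
        (summable_rpow_add (by linarith) 1).mul_left _, ?_⟩
      have c1 : Continuous fun p : ℂ × ℂ × ℂ => ‖p.1‖ := by fun_prop
      have c2 : Continuous fun p : ℂ × ℂ × ℂ => ‖p.1 + p.2.2‖ := by fun_prop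
      have c3 : Continuous fun p : ℂ × ℂ × ℂ => (p.1 + p.2.2).re :=
        Complex.continuous_re.comp (by fun_prop)
      have c4 : Continuous fun p : ℂ × ℂ × ℂ => (p.1 + p.2.1 + p.2.2).re :=
        Complex.continuous_re.comp (by fun_prop)
      filter_upwards [isOpen_avDomain_one.mem_nhds hp,
        c1.continuousAt.eventually (gt_mem_nhds (show ‖p.1‖ < R by
          linarith [norm_nonneg (p.1 + p.2.2)])),
        c2.continuousAt.eventually (gt_mem_nhds (show ‖p.1 + p.2.2‖ < R by
          linarith [norm_nonneg p.1])),
        c3.continuousAt.eventually (lt_mem_nhds (half_lt_self ha)),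
        c4.continuousAt.eventually (lt_mem_nhds (show (b - 1) / 2 + 1 < b by linarith))]
        with z hz h1 h2 h3 h4 n
      refine (norm_avRest_term_le (mapsTo_tailDomain hz) h1.le h2.le).trans ?_
      have hA : 0 ≤ ∑' j : ℕ, (R + j) * risingCoeff j R * (1 / 2) ^ j := tsum_nonneg fun j => by
        have := risingCoeff_nonneg hR0 j
        positivity
      have h5 : 0 < (p.1 + p.2.2).re / 2 := half_pos ha
      gcongr
      · exact_mod_cast (by omega : 1 ≤ 1 + n)
      · linarith

noncomputable section

/-- The term of the Apostol-Vu series with smaller variable `n + 1` and `k` the sum of both. -/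
def avTerm (s₁ s₂ s₃ : ℂ) (n k : ℕ) : ℂ :=
  if 2 * (n + 1) < k then
    ((n + 1 : ℕ) : ℂ) ^ (-s₂) * (((k : ℂ) - (n + 1 : ℕ)) ^ (-s₁) * (k : ℂ) ^ (-s₃)) else 0

end

lemma summable_avTerm {s₁ s₂ s₃ : ℂ} (h₁ : 1 < s₁.re) (h₂ : 1 < s₂.re) (h₃ : 1 < s₃.re) :
    Summable fun x : ℕ × ℕ => avTerm s₁ s₂ s₃ x.1 x.2 := by
  have e1 : Summable fun n : ℕ => ((n + 1 : ℕ) : ℝ) ^ (-s₂.re) :=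
    (summable_nat_add_iff 1).2 (Real.summable_nat_rpow.2 (by linarith))
  have e2 : Summable fun k : ℕ => (k : ℝ) ^ (-s₃.re) := Real.summable_nat_rpow.2 (by linarith)
  refine Summable.of_norm_bounded (e1.mul_of_nonneg e2 (fun n => by positivity)
    (fun k => by positivity)) fun x => ?_
  obtain ⟨n, k⟩ := x
  simp only [avTerm]
  split_ifs with h
  · have hsub : (k : ℂ) - (n + 1 : ℕ) = ((k - (n + 1) : ℕ) : ℂ) := by
      rw [Nat.cast_sub (by omega)]
    rw [hsub, norm_mul, norm_mul, norm_natCast_cpow_neg (by omega), norm_natCast_cpow_neg (by omega),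
      norm_natCast_cpow_neg (by omega)]
    have : ((k - (n + 1) : ℕ) : ℝ) ^ (-s₁.re) ≤ 1 :=
      Real.rpow_le_one_of_one_le_of_nonpos (by exact_mod_cast (by omega)) (by linarith)
    gcongr
    exact mul_le_of_le_one_left (by positivity) this
  · simp; positivity

/-- The passage from the larger variable `m` to the sum k = m + (n + 1), the smaller variable being
n + 1; the omitted values of `k` carry zero terms. -/
lemma tsum_tsum_add_eq {f : ℕ → ℕ → ℂ} (hs : Summable fun x : ℕ × ℕ => f x.1 x.2)
    (hf : ∀ n k, k ≤ n → f n k = 0) :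
    ∑' m : ℕ, ∑' n : ℕ, f n (m + (n + 1)) = ∑' n : ℕ, ∑' k : ℕ, f n k := by
  have hinj : Function.Injective fun x : ℕ × ℕ => (x.2, x.1 + (x.2 + 1)) := by
    intro x y h
    have h1 := congrArg Prod.fst h
    have h2 := congrArg Prod.snd h
    simp only at h1 h2
    exact Prod.ext (by omega) h1
  have hs1 : Summable fun x : ℕ × ℕ => f x.2 (x.1 + (x.2 + 1)) := hs.comp_injective hinj
  have hs2 : Summable (Function.uncurry fun m n : ℕ => f n (m + (n + 1))) := by
    simpa only [Function.uncurry_def] using hs1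
  rw [← Summable.tsum_comm hs2]
  refine tsum_congr fun n => ?_
  refine Function.Injective.tsum_eq (g := fun m : ℕ => m + (n + 1))
    (f := fun k => f n k) (add_left_injective (n + 1)) fun k hk => ?_
  by_cases h : n < k
  · exact ⟨k - (n + 1), Nat.sub_add_cancel (by omega)⟩
  · exact absurd (hf n k (by omega)) hk

lemma avSeries_eq_tsum {s₁ s₂ s₃ : ℂ} (h₁ : 1 < s₁.re) (h₂ : 1 < s₂.re) (h₃ : 1 < s₃.re) :
    avSeries s₁ s₂ s₃ = ∑' n : ℕ, ∑' k : ℕ, avTerm s₁ s₂ s₃ n k := by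
  rw [← tsum_tsum_add_eq (summable_avTerm h₁ h₂ h₃) fun n k h => if_neg (by omega)]
  refine tsum_congr fun m => ?_
  rw [tsum_eq_sum (s := Finset.range (m - 1)), Finset.sum_Ico_eq_sum_range]
  · refine Finset.sum_congr rfl fun n hn => ?_
    rw [Finset.mem_range] at hn
    rw [avTerm, if_pos (by omega)]
    push_cast
    rw [Complex.cpow_neg, Complex.cpow_neg, Complex.cpow_neg]
    have a1 : (m : ℂ) + (n + 1) - (n + 1) = m := by ring
    rw [a1, add_comm (1 : ℂ) n, one_div, mul_inv, mul_inv]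
    ring
  · intro n hn
    rw [Finset.mem_range] at hn
    rw [avTerm, if_neg (by omega)]

lemma hasSum_avTerm {s₁ s₂ s₃ : ℂ} (k : ℕ) :
    HasSum (fun n => avTerm s₁ s₂ s₃ n k) (avCoeff s₁ s₂ k * (1 / (k : ℂ) ^ s₃)) := by
  have h : avCoeff s₁ s₂ k * (1 / (k : ℂ) ^ s₃) = ∑ n ∈ Finset.range k, avTerm s₁ s₂ s₃ n k := by
    simp only [avTerm]
    rw [← Finset.sum_filter, avCoeff, Finset.sum_mul]
    refine Finset.sum_nbij' (fun m => k - m - 1) (fun n => k - (n + 1)) ?_ ?_ ?_ ?_ ?_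
    · intro m hm
      simp only [Finset.mem_filter, Finset.mem_Ico, Finset.mem_range] at hm ⊢
      omega
    · intro m hm
      simp only [Finset.mem_filter, Finset.mem_Ico, Finset.mem_range] at hm ⊢
      omega
    · intro m hm
      simp only [Finset.mem_filter, Finset.mem_Ico] at hm ⊢
      omega
    · intro m hm
      simp only [Finset.mem_filter, Finset.mem_range] at hm ⊢
      omega
    · intro m hm
      simp only [Finset.mem_filter, Finset.mem_Ico] at hm
      have e1 : k - m - 1 + 1 = k - m := by omega
      rw [e1, Nat.cast_sub (by omega), sub_sub_cancel, Complex.cpow_neg, Complex.cpow_neg,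
        Complex.cpow_neg, one_div, one_div, mul_inv]
      ring
  rw [h]
  refine hasSum_sum_of_ne_finset_zero fun n hn => ?_
  rw [Finset.mem_range] at hn
  rw [avTerm, if_neg (by omega)]

/-- For each smaller variable n + 1 the sum over `k` is cut at 2 max(n + 1, M). The lower part
differs from `avPartial` in nothing, as no term with k ≤ 2(n + 1) occurs; the upper part is expanded
binomially. -/
lemma avSeries_eq_avPartial_add_avRest {M : ℕ} (hM : 0 < M) {s₁ s₂ s₃ : ℂ} (h₁ : 1 < s₁.re)
    (h₂ : 1 < s₂.re) (h₃ : 1 < s₃.re) :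
    avSeries s₁ s₂ s₃ = avPartial M (s₁, s₂, s₃) + avRest M (s₁, s₂, s₃) := by
  have hs := summable_avTerm h₁ h₂ h₃
  set w := s₁ + s₃ with hw
  have hwre : 1 < w.re := by simp [hw]; linarith
  have hq : (s₁, w) ∈ tailDomain := ⟨by simp only; linarith, by rintro h; simp only at h; rw [h] at hwre; simp at hwre⟩
  set K : ℕ → ℕ := fun n => 2 * max (n + 1) M with hK
  have hK2 : ∀ n, 2 * (n + 1) ≤ K n := fun n => by simp only [hK]; omega
  set P : ℕ → ℂ := fun n => ((n + 1 : ℕ) : ℂ) ^ (-s₂) *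
    ((K n : ℂ) ^ (1 - w) * polePart (((n + 1 : ℕ) : ℝ) / (K n : ℝ)) (s₁, w)) with hP
  set Q : ℕ → ℂ := fun n => ((n + 1 : ℕ) : ℂ) ^ (-s₂) * tailPart (n + 1) (K n) (s₁, w) with hQ
  have split : ∀ n, ∑' k, avTerm s₁ s₂ s₃ n k =
      ∑ k ∈ Finset.range (2 * M + 1), avTerm s₁ s₂ s₃ n k + (P n + Q n) := by
    intro n
    have hsn : Summable fun k => avTerm s₁ s₂ s₃ n k := hs.prod_factor n
    rw [← hsn.sum_add_tsum_nat_add (K n + 1)]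
    congr 1
    · symm
      refine Finset.sum_subset (Finset.range_subset_range.2 (by simp only [hK]; omega)) fun k hk hk' => ?_
      rw [Finset.mem_range] at hk hk'
      rw [avTerm, if_neg]
      simp only [hK] at hk
      omega
    · have e := tsum_sub_cpow_mul_cpow (n := n + 1) (K := K n) (by omega) (hK2 n) (s := s₁) hwre
      simp only [hP, hQ]
      rw [← mul_add, ← e, ← tsum_mul_left]
      refine tsum_congr fun i => ?_
      have h2 := hK2 n
      rw [avTerm, if_pos (by omega), add_comm i (K n + 1), show -(w - s₁) = -s₃ by rw [hw]; ring]
  -- From index `M` on, the cut is twice the smaller variable, so the ratio is always 1/2 and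
  -- `polePart` becomes a common factor. What remains is a zeta tail at s₁ + s₂ + s₃ - 1, the source
  -- of the pole on s₁ + s₂ + s₃ = 2.
  have hPM : ∀ i, P (i + M) = 2 ^ (1 - w) * polePart (1 / 2) (s₁, w) *
      ((M + 1 + i : ℕ) : ℂ) ^ (-(s₁ + s₂ + s₃ - 1)) := by
    intro i
    have hKi : K (i + M) = 2 * (M + 1 + i) := by simp only [hK]; omega
    have hi : i + M + 1 = M + 1 + i := by ring
    have hne : ((M + 1 + i : ℕ) : ℂ) ≠ 0 := by exact_mod_cast (by omega)
    have hner : ((M + 1 + i : ℕ) : ℝ) ≠ 0 := by exact_mod_cast (by omega)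
    simp only [hP]
    rw [hKi, hi]
    have e1 : ((M + 1 + i : ℕ) : ℝ) / ((2 * (M + 1 + i) : ℕ) : ℝ) = 1 / 2 := by
      rw [Nat.cast_mul]; push_cast at hner ⊢; field_simp
    have e2 : ((2 * (M + 1 + i) : ℕ) : ℂ) ^ (1 - w) = 2 ^ (1 - w) * ((M + 1 + i : ℕ) : ℂ) ^ (1 - w) := by
      rw [Nat.cast_mul, Complex.natCast_mul_natCast_cpow]; norm_num
    rw [e1, e2, show -(s₁ + s₂ + s₃ - 1) = -s₂ + (1 - w) by rw [hw]; ring, Complex.cpow_add _ _ hne]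
    ring
  have hW : 1 < (s₁ + s₂ + s₃ - 1).re := by simp; linarith
  have hPs : Summable P := by
    rw [← summable_nat_add_iff M]
    simp only [hPM]
    exact (summable_natCast_cpow_neg (by omega) hW).mul_left _
  have hQs : Summable Q := by
    have hbs : Summable fun n : ℕ => ((1 + n : ℕ) : ℝ) ^ (-((s₁ + s₂ + s₃).re - 1) - 1) :=
      summable_rpow_add (by simp; linarith) 1
    refine Summable.of_norm_bounded (hbs.mul_left ((∑' j : ℕ, (‖s₁‖ + ‖s₁ + s₃‖ + j) *
      risingCoeff j (‖s₁‖ + ‖s₁ + s₃‖) * (1 / 2) ^ j) * (1 + 1 / (s₁ + s₃).re))) fun n => ?_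
    have := norm_avRest_term_le (M := M) (n := n) (p := (s₁, s₂, s₃)) hq
      (R := ‖s₁‖ + ‖s₁ + s₃‖) (by simp) (by simp)
    refine this.trans (le_of_eq ?_)
    congr 2
    ring
  have hA : HasSum (fun n => ∑ k ∈ Finset.range (2 * M + 1), avTerm s₁ s₂ s₃ n k)
      (avPartial M (s₁, s₂, s₃)) := hasSum_sum fun k _ => hasSum_avTerm k
  rw [avSeries_eq_tsum h₁ h₂ h₃]
  simp_rw [split]
  rw [hA.summable.tsum_add (hPs.add hQs), hA.tsum_eq, hPs.tsum_add hQs]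
  congr 1
  rw [avRest]
  congr 1
  rw [← hPs.sum_add_tsum_nat_add M]
  congr 1
  · refine Finset.sum_congr rfl fun n hn => ?_
    rw [Finset.mem_range] at hn
    have : K n = 2 * M := by simp only [hK]; omega
    simp only [hP, this, hw]
  · simp only [hPM]
    rw [tsum_mul_left, tsum_cpow_eq hM hW]

lemma isAVContinuation_avPartial_add_avRest {M : ℕ} (hM : 0 < M) :
    IsAVContinuation 1 fun p => avPartial M p + avRest M p :=
  ⟨(differentiable_avPartial M).differentiableOn.add (differentiableOn_avRest hM),
    fun _ _ _ h₁ h₂ h₃ => (avSeries_eq_avPartial_add_avRest hM h₁ h₂ h₃).symm⟩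

lemma avZeta_eq {M : ℕ} (hM : 0 < M) {s₁ s₂ s₃ : ℂ} (hp : (s₁, s₂, s₃) ∈ avDomain 1) :
    avZeta s₁ s₂ s₃ = avPartial M (s₁, s₂, s₃) + avRest M (s₁, s₂, s₃) :=
  avZeta_eq_of_isAVContinuation (isAVContinuation_avPartial_add_avRest hM) hp

/-! ### Bounds for the coefficients and for the remainder. -/

/-- The decay in `K` is divided: the exponent α is spent on `M`, the rest on `n`. With a = σ₁ + σ₃
and σ = σ₂, the sum over `n` converges exactly when α < b - 1. -/
lemma rpow_neg_mul_rpow_neg_le {n M K : ℕ} (hn : 0 < n) (hM : 0 < M) (hnK : n ≤ K) (hMK : M ≤ K)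
    {a σ α : ℝ} (hα : 0 ≤ α) (ha : α ≤ a) :
    (n : ℝ) ^ (-σ) * (K : ℝ) ^ (-a) ≤ (M : ℝ) ^ (-α) * (n : ℝ) ^ (-(σ + a - α)) := by
  have hn' : (0 : ℝ) < n := by exact_mod_cast hn
  have hM' : (0 : ℝ) < M := by exact_mod_cast hM
  have hK' : (0 : ℝ) < K := by exact_mod_cast hn.trans_le hnK
  have e1 : -a = -α + -(a - α) := by ring
  have e2 : -(σ + a - α) = -σ + -(a - α) := by ring
  rw [e1, e2, Real.rpow_add hK', Real.rpow_add hn']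
  have h1 : (K : ℝ) ^ (-α) ≤ (M : ℝ) ^ (-α) :=
    Real.rpow_le_rpow_of_nonpos hM' (by exact_mod_cast hMK) (by linarith)
  have h2 : (K : ℝ) ^ (-(a - α)) ≤ (n : ℝ) ^ (-(a - α)) :=
    Real.rpow_le_rpow_of_nonpos hn' (by exact_mod_cast hnK) (by linarith)
  calc _ ≤ (n : ℝ) ^ (-σ) * ((M : ℝ) ^ (-α) * (n : ℝ) ^ (-(a - α))) := by gcongr
    _ = _ := by ring

lemma summable_succ_rpow {β : ℝ} (hβ : 1 < β) : Summable fun n : ℕ => ((n + 1 : ℕ) : ℝ) ^ (-β) :=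
  (summable_nat_add_iff 1).2 (Real.summable_nat_rpow.2 (by linarith))

/-- Here m > k/2 and σ₁ ≥ 0 give m^{-σ₁} ≪ k^{-σ₁}, while k - m ≤ k lets a power a - α of k - m be
traded for one of `k`. The remaining sum of (k - m)^{-(b-α)} is bounded because b - α > 1. -/
lemma exists_norm_avCoeff_le {s₁ s₂ : ℂ} {σ₃ α : ℝ} (hσ₁ : 0 ≤ s₁.re) (ha : α ≤ s₁.re + σ₃)
    (hb : α < s₁.re + s₂.re + σ₃ - 1) :
    ∃ A ≥ (0 : ℝ), ∀ k : ℕ, ‖avCoeff s₁ s₂ k‖ * (k : ℝ) ^ (-σ₃) ≤ A * (k : ℝ) ^ (-α) := by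
  set β := s₁.re + s₂.re + σ₃ - α with hβ
  have hs : Summable fun n : ℕ => (n : ℝ) ^ (-β) := Real.summable_nat_rpow.2 (by linarith)
  refine ⟨2 ^ s₁.re * ∑' n : ℕ, (n : ℝ) ^ (-β), by positivity, fun k => ?_⟩
  rcases k.eq_zero_or_pos with rfl | hk
  · simp [avCoeff]; positivity
  have hk' : (0 : ℝ) < k := by exact_mod_cast hk
  have key : ‖avCoeff s₁ s₂ k‖ ≤
      2 ^ s₁.re * (k : ℝ) ^ (σ₃ - α) * ∑' n : ℕ, (n : ℝ) ^ (-β) := by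
    have hterm : ∀ m ∈ (Finset.Ico 1 k).filter (fun m => k < 2 * m),
        ‖1 / ((m : ℂ) ^ s₁ * ((k : ℂ) - (m : ℂ)) ^ s₂)‖ ≤
          2 ^ s₁.re * (k : ℝ) ^ (σ₃ - α) * ((k - m : ℕ) : ℝ) ^ (-β) := by
      intro m hm
      simp only [Finset.mem_filter, Finset.mem_Ico] at hm
      have hm' : (0 : ℝ) < m := by exact_mod_cast (by omega : 0 < m)
      have hn' : (0 : ℝ) < ((k - m : ℕ) : ℝ) := by exact_mod_cast (by omega : 0 < k - m)
      rw [← Nat.cast_sub (by omega), one_div, mul_inv, ← Complex.cpow_neg, ← Complex.cpow_neg,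
        norm_mul, norm_natCast_cpow_neg (by omega), norm_natCast_cpow_neg (by omega)]
      have h1 : (m : ℝ) ^ (-s₁.re) ≤ 2 ^ s₁.re * (k : ℝ) ^ (-s₁.re) := by
        have : (k / 2 : ℝ) ^ (-s₁.re) = 2 ^ s₁.re * (k : ℝ) ^ (-s₁.re) := by
          rw [Real.div_rpow hk'.le (by norm_num), Real.rpow_neg (by norm_num : (0 : ℝ) ≤ 2), div_inv_eq_mul,
            mul_comm]
        rw [← this]
        refine Real.rpow_le_rpow_of_nonpos (by positivity) ?_ (by linarith)
        have : (k : ℝ) < 2 * m := by exact_mod_cast hm.2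
        linarith
      have h2 : ((k - m : ℕ) : ℝ) ^ (-s₂.re) ≤
          (k : ℝ) ^ (s₁.re + σ₃ - α) * ((k - m : ℕ) : ℝ) ^ (-β) := by
        have : -s₂.re = (s₁.re + σ₃ - α) + -β := by rw [hβ]; ring
        rw [this, Real.rpow_add hn']
        gcongr
        exact Nat.sub_le k m
      calc _ ≤ (2 ^ s₁.re * (k : ℝ) ^ (-s₁.re)) *
            ((k : ℝ) ^ (s₁.re + σ₃ - α) * ((k - m : ℕ) : ℝ) ^ (-β)) := by gcongr
        _ = 2 ^ s₁.re * ((k : ℝ) ^ (-s₁.re) * (k : ℝ) ^ (s₁.re + σ₃ - α)) *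
            ((k - m : ℕ) : ℝ) ^ (-β) := by ring
        _ = _ := by rw [← Real.rpow_add hk']; congr 3; ring
    rw [avCoeff]
    refine (norm_sum_le_of_le _ hterm).trans ?_
    rw [← Finset.mul_sum]
    gcongr
    have hinj : Set.InjOn (fun m => k - m) (((Finset.Ico 1 k).filter (fun m => k < 2 * m) :
        Finset ℕ) : Set ℕ) := by
      intro x hx y hy hxy
      simp only [Finset.coe_filter, Finset.mem_Ico, Set.mem_ofPred_eq] at hx hy hxy
      omega
    have e := Finset.sum_image (f := fun n : ℕ => (n : ℝ) ^ (-β)) hinj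
    rw [← e]
    exact hs.sum_le_tsum _ fun n _ => by positivity
  calc _ ≤ (2 ^ s₁.re * (k : ℝ) ^ (σ₃ - α) * ∑' n : ℕ, (n : ℝ) ^ (-β)) * (k : ℝ) ^ (-σ₃) := by gcongr
    _ = (2 ^ s₁.re * ∑' n : ℕ, (n : ℝ) ^ (-β)) * ((k : ℝ) ^ (σ₃ - α) * (k : ℝ) ^ (-σ₃)) := by ring
    _ = _ := by rw [← Real.rpow_add hk']; congr 2; ring

/-- The lower bound M ≥ Ct allows the uniform estimates for the zeta tails. The upper bound M ≤ Dt
converts the factor 1/t in the pole parts into D/M, which cancels the extra power of `M` in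
(2M)^{1-w} and in M^{2-(s₁+s₂+s₃)}. -/
lemma exists_norm_avRest_le (s₁ s₂ : ℂ) {σ₃ α : ℝ} (hα : 0 < α)
    (ha : α ≤ s₁.re + σ₃) (hb : α < s₁.re + s₂.re + σ₃ - 1) :
    ∃ C ≥ (1 : ℝ), ∀ D ≥ (0 : ℝ), ∃ A ≥ (0 : ℝ), ∃ T₀ : ℝ, ∀ t ≥ T₀, ∀ M : ℕ, C * t ≤ M → M ≤ D * t →
      ‖avRest M (s₁, s₂, (σ₃ : ℂ) + t * Complex.I)‖ ≤ A * (M : ℝ) ^ (-α) := by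
  obtain ⟨C₁, hC₁, hA₁⟩ := exists_norm_tailPart_le s₁
  obtain ⟨A₁, hA₁0, hA₁⟩ := hA₁ α hα
  obtain ⟨C₂, hC₂, A₂, hA₂0, hA₂⟩ := exists_norm_zetaTail_le
  set a := s₁.re + σ₃ with hadef
  set b := s₁.re + s₂.re + σ₃ with hbdef
  set B := ∑' j, risingCoeff j ‖s₁‖ * (1 / 2) ^ j with hBdef
  have hB0 : 0 ≤ B := tsum_nonneg fun j =>
    mul_nonneg (risingCoeff_nonneg (norm_nonneg _) j) (by positivity)
  have hZs : Summable fun n : ℕ => ((n + 1 : ℕ) : ℝ) ^ (-(b - α)) := summable_succ_rpow (by linarith)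
  set Z := ∑' n : ℕ, ((n + 1 : ℕ) : ℝ) ^ (-(b - α)) with hZ
  have hZ0 : 0 ≤ Z := tsum_nonneg fun n => by positivity
  set A' := A₂ * (1 + 1 / (b - 1)) with hA'
  have hb1 : 0 < b - 1 := by linarith
  have hA'0 : 0 ≤ A' := by positivity
  -- For t beyond the last bound listed, |w| and |s₁ + s₂ + s₃ - 1| are at most 2t, and the relevant
  -- imaginary parts are at least t/2. The constant C₁ enters only once because the tails of the
  -- first kind start at 2M or later.
  refine ⟨C₁ + 2 * C₂, by linarith, fun D hD => ⟨4 * B * D * Z + (2 ^ (1 - a) * (B * 2) *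
    (2 * D + A')) + A₁ * Z, by positivity, 2 + 2 * ‖s₁‖ + 2 * ‖s₂‖ + 2 * |σ₃|, ?_⟩⟩
  intro t ht M hCM hMD
  have n1 := norm_nonneg s₁
  have n2 := norm_nonneg s₂
  have n3 := abs_nonneg σ₃
  have ht2 : 2 ≤ t := by linarith
  have ht0 : 0 < t := by linarith
  have hMpos : (0 : ℝ) < M := lt_of_lt_of_le (by positivity) hCM
  have hM : 0 < M := by exact_mod_cast hMpos
  have hM1 : (1 : ℝ) ≤ M := by exact_mod_cast hM
  set s₃ : ℂ := (σ₃ : ℂ) + t * Complex.I with hs₃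
  have im1 : |s₁.im| ≤ ‖s₁‖ := Complex.abs_im_le_norm s₁
  have im2 : |s₂.im| ≤ ‖s₂‖ := Complex.abs_im_le_norm s₂
  have hs₃n : ‖s₃‖ ≤ |σ₃| + t := by
    refine (norm_add_le _ _).trans (le_of_eq ?_)
    simp [abs_of_pos ht0]
  set w := s₁ + s₃ with hw
  set W := s₁ + s₂ + s₃ with hW
  have hwre : w.re = a := by simp [hw, hs₃, hadef]
  have hWre : W.re = b := by simp [hW, hs₃, hbdef]
  have hwim : w.im = s₁.im + t := by simp [hw, hs₃]
  have hWim : W.im = s₁.im + s₂.im + t := by simp [hW, hs₃]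
  have hwn : ‖w‖ ≤ 2 * t := (norm_add_le _ _).trans (by linarith)
  have hWn : ‖W - 1‖ ≤ 2 * t := by
    refine (norm_sub_le _ _).trans ?_
    have := norm_add_le (s₁ + s₂) s₃
    have := norm_add_le s₁ s₂
    rw [norm_one]
    linarith
  have hCt : C₁ * t + 2 * C₂ * t ≤ M := by rwa [← add_mul]
  have hC₁t : 0 ≤ C₁ * t := by positivity
  have hC₂t : 0 ≤ C₂ * t := by positivity
  have hCw : C₁ * ‖w‖ ≤ 2 * M := by
    have : C₁ * ‖w‖ ≤ C₁ * (2 * t) := by gcongr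
    linarith
  have hCW : C₂ * ‖W - 1‖ ≤ M := by
    have : C₂ * ‖W - 1‖ ≤ C₂ * (2 * t) := by gcongr
    linarith
  have hwim2 : t / 2 ≤ |w.im| := by
    rw [hwim]
    refine le_trans ?_ (le_abs_self _)
    linarith [neg_abs_le s₁.im]
  have hWim2 : t / 2 ≤ |W.im| := by
    rw [hWim]
    refine le_trans ?_ (le_abs_self _)
    linarith [neg_abs_le s₁.im, neg_abs_le s₂.im]
  have hti : 1 / t ≤ D / M := by
    rw [div_le_div_iff₀ ht0 hMpos]; linarith
  have hq : ((s₁, w) : ℂ × ℂ) ∈ tailDomain := by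
    refine ⟨by simp only [hwre]; linarith, fun h => ?_⟩
    simp only at h
    rw [h] at hwim2
    norm_num at hwim2
    linarith
  have hpole : ∀ x : ℝ, 0 ≤ x → x ≤ 1 / 2 → ‖polePart x (s₁, w)‖ ≤ B * (2 * (1 / t)) := by
    intro x hx0 hx1
    refine (norm_polePart_le hx0 hx1 (q := (s₁, w)) (by
      simp only; intro h; rw [h] at hwim2; simp at hwim2; linarith)).trans ?_
    gcongr
    calc 1 / |w.im| ≤ 1 / (t / 2) := by gcongr
      _ = 2 * (1 / t) := by field_simp
  have hβe : -(s₂.re + a - α) = -(b - α) := by rw [hadef, hbdef]; ring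
  rw [avRest]
  simp only
  rw [← hw, ← hW]
  refine (norm_add_le _ _).trans ((add_le_add (norm_add_le _ _) le_rfl).trans ?_)
  rw [add_mul, add_mul]
  refine add_le_add (add_le_add ?_ ?_) ?_
  · have hterm : ∀ n ∈ Finset.range M, ‖((n + 1 : ℕ) : ℂ) ^ (-s₂) * (((2 * M : ℕ) : ℂ) ^ (1 - w) *
        polePart (((n + 1 : ℕ) : ℝ) / ((2 * M : ℕ) : ℝ)) (s₁, w))‖ ≤
        4 * B * D * (M : ℝ) ^ (-α) * ((n + 1 : ℕ) : ℝ) ^ (-(b - α)) := by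
      intro n hn
      have hn' : n + 1 ≤ M := Finset.mem_range.1 hn
      have h2M : (0 : ℝ) < ((2 * M : ℕ) : ℝ) := by positivity
      have hp := hpole (((n + 1 : ℕ) : ℝ) / ((2 * M : ℕ) : ℝ)) (by positivity) (by
        rw [div_le_div_iff₀ h2M (by norm_num)]
        exact_mod_cast (by omega : (n + 1) * 2 ≤ 1 * (2 * M)))
      have hr := rpow_neg_mul_rpow_neg_le (n := n + 1) (M := M) (K := 2 * M) (by omega) hM
        (by omega) (by omega) (σ := s₂.re) hα.le ha
      rw [hβe] at hr
      rw [norm_mul, norm_mul, norm_natCast_cpow_neg (by omega),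
        Complex.norm_natCast_cpow_of_pos (by omega)]
      have e : (1 - w).re = 1 + -a := by simp [hwre]; ring
      rw [e, Real.rpow_add h2M, Real.rpow_one]
      calc _ ≤ ((n + 1 : ℕ) : ℝ) ^ (-s₂.re) * (((2 * M : ℕ) : ℝ) * ((2 * M : ℕ) : ℝ) ^ (-a) *
            (B * (2 * (D / M)))) := by gcongr; exact hp.trans (by gcongr)
        _ = 4 * B * D * (((n + 1 : ℕ) : ℝ) ^ (-s₂.re) * ((2 * M : ℕ) : ℝ) ^ (-a)) := by
            push_cast; field_simp; ring
        _ ≤ 4 * B * D * ((M : ℝ) ^ (-α) * ((n + 1 : ℕ) : ℝ) ^ (-(b - α))) := by gcongr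
        _ = _ := by ring
    refine (norm_sum_le_of_le _ hterm).trans ?_
    rw [← Finset.mul_sum]
    calc _ ≤ 4 * B * D * (M : ℝ) ^ (-α) * Z := by
          gcongr
          exact hZs.sum_le_tsum _ fun n _ => by positivity
      _ = _ := by ring
  · have hp := hpole (1 / 2) (by norm_num) le_rfl
    have hp' : ‖polePart (1 / 2) (s₁, w)‖ ≤ B * 2 := by
      refine hp.trans ?_
      gcongr
      have : 1 / t ≤ 1 := by rw [div_le_one ht0]; linarith
      linarith
    have hz : ‖zetaTail M (W - 1)‖ ≤ A' * (M : ℝ) ^ (-(b - 1)) := by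
      have h1 := hA₂ (W - 1) M (by simp [hWre]; linarith) (by simp; linarith) hCW
      have e : (W - 1).re = b - 1 := by simp [hWre]
      rw [e] at h1
      exact h1
    have hm : ‖(M : ℂ) ^ (1 - (W - 1)) / (W - 1 - 1)‖ ≤ 2 * D * (M : ℝ) ^ (-(b - 1)) := by
      rw [norm_div, Complex.norm_natCast_cpow_of_pos hM]
      have e : (1 - (W - 1)).re = 1 + -(b - 1) := by simp [hWre]; ring
      have h1 : t / 2 ≤ ‖W - 1 - 1‖ := by
        refine hWim2.trans ?_
        simpa using Complex.abs_im_le_norm (W - 1 - 1)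
      rw [e, Real.rpow_add hMpos, Real.rpow_one]
      calc _ ≤ (M : ℝ) * (M : ℝ) ^ (-(b - 1)) / (t / 2) := by gcongr
        _ = 2 * ((M : ℝ) * (M : ℝ) ^ (-(b - 1))) * (1 / t) := by field_simp
        _ ≤ 2 * ((M : ℝ) * (M : ℝ) ^ (-(b - 1))) * (D / M) := by gcongr
        _ = _ := by field_simp
    have h2 : ‖(2 : ℂ) ^ (1 - w)‖ = 2 ^ (1 - a) := by
      have := Complex.norm_natCast_cpow_of_pos (n := 2) (by norm_num) (1 - w)
      simpa [hwre] using this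
    have hMb : (M : ℝ) ^ (-(b - 1)) ≤ (M : ℝ) ^ (-α) :=
      Real.rpow_le_rpow_of_exponent_le hM1 (by linarith)
    rw [norm_mul, norm_mul, h2]
    calc _ ≤ 2 ^ (1 - a) * (B * 2) * (2 * D * (M : ℝ) ^ (-(b - 1)) + A' * (M : ℝ) ^ (-(b - 1))) := by
          gcongr
          exact (norm_add_le _ _).trans (add_le_add hm hz)
      _ = 2 ^ (1 - a) * (B * 2) * (2 * D + A') * (M : ℝ) ^ (-(b - 1)) := by ring
      _ ≤ _ := by gcongr
  · rw [mul_right_comm, hZ, ← tsum_mul_left]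
    refine tsum_of_norm_bounded (hZs.mul_left _).hasSum fun n => ?_
    obtain ⟨K, hK⟩ : ∃ K, K = 2 * max (n + 1) M := ⟨_, rfl⟩
    rw [← hK]
    have hK1 : 2 * (n + 1) ≤ K := by omega
    have hK2 : 2 * M ≤ K := by omega
    have hK2r : (2 : ℝ) * M ≤ K := by exact_mod_cast hK2
    have hCK : C₁ * ‖w‖ ≤ K := hCw.trans hK2r
    have ht' := hA₁ w (n + 1) K n.succ_pos hK1 (hwre ▸ ha) (by linarith) hCK
    have hr := rpow_neg_mul_rpow_neg_le (n := n + 1) (M := M) (K := K) n.succ_pos hM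
        (by omega) (by omega) (σ := s₂.re) hα.le ha
    rw [hβe] at hr
    rw [hwre] at ht'
    rw [norm_mul, norm_natCast_cpow_neg n.succ_pos]
    refine (mul_le_mul_of_nonneg_left ht' (by positivity)).trans ?_
    calc _ = A₁ * (((n + 1 : ℕ) : ℝ) ^ (-s₂.re) * (K : ℝ) ^ (-a)) := by ring
      _ ≤ A₁ * ((M : ℝ) ^ (-α) * ((n + 1 : ℕ) : ℝ) ^ (-(b - α))) :=
          mul_le_mul_of_nonneg_left hr hA₁0
      _ = _ := by ring

/-! ### Mean squares of Dirichlet polynomials and dyadic summation. -/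

lemma norm_integral_exp_le {A B c : ℝ} (hc : c ≠ 0) :
    ‖∫ t in A..B, Complex.exp (((c : ℂ) * Complex.I) * t)‖ ≤ 2 / |c| := by
  have hc' : (c : ℂ) * Complex.I ≠ 0 := mul_ne_zero (by exact_mod_cast hc) Complex.I_ne_zero
  rw [integral_exp_mul_complex hc', norm_div, norm_mul, Complex.norm_real, Complex.norm_I, mul_one,
    Real.norm_eq_abs]
  gcongr
  refine (norm_sub_le _ _).trans ?_
  have : ∀ x : ℝ, ‖Complex.exp ((c : ℂ) * Complex.I * x)‖ = 1 := fun x => by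
    rw [show (c : ℂ) * Complex.I * x = ((c * x : ℝ) : ℂ) * Complex.I by push_cast; ring]
    exact Complex.norm_exp_ofReal_mul_I _
  rw [this, this]
  norm_num

lemma natCast_cpow_neg_mul_I {k : ℕ} (hk : 0 < k) (t : ℝ) :
    (k : ℂ) ^ (-(t * Complex.I)) = Complex.exp (((-Real.log k : ℝ) * Complex.I) * t) := by
  have hkc : (k : ℂ) ≠ 0 := by exact_mod_cast hk.ne'
  rw [Complex.cpow_def_of_ne_zero hkc, Complex.natCast_log.symm]
  congr 1
  push_cast
  ring

/-- The mean square of a Dirichlet polynomial, up to the off-diagonal terms. -/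
lemma abs_integral_norm_sq_dirichlet_sub_le (β : ℕ → ℂ) (S : Finset ℕ) (hS : ∀ k ∈ S, 0 < k)
    (A B : ℝ) :
    |(∫ t in A..B, ‖∑ k ∈ S, β k * (k : ℂ) ^ (-(t * Complex.I))‖ ^ 2) -
        (B - A) * ∑ k ∈ S, ‖β k‖ ^ 2| ≤
      ∑ k ∈ S, ∑ l ∈ S, ‖β k‖ * ‖β l‖ * (2 / |Real.log l - Real.log k|) := by
  set g : ℕ → ℕ → ℝ → ℂ := fun k l t => β k * starRingEnd ℂ (β l) *
    Complex.exp (((Real.log l - Real.log k : ℝ) * Complex.I) * t) with hg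
  have hsq : ∀ t : ℝ, ((‖∑ k ∈ S, β k * (k : ℂ) ^ (-(t * Complex.I))‖ ^ 2 : ℝ) : ℂ) =
      ∑ k ∈ S, ∑ l ∈ S, g k l t := by
    intro t
    rw [Complex.ofReal_pow, ← Complex.mul_conj', map_sum, Finset.sum_mul_sum]
    refine Finset.sum_congr rfl fun k hk => Finset.sum_congr rfl fun l hl => ?_
    rw [natCast_cpow_neg_mul_I (hS k hk), natCast_cpow_neg_mul_I (hS l hl), map_mul,
      ← Complex.exp_conj, hg]
    simp only [map_mul, Complex.conj_ofReal, Complex.conj_I]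
    rw [mul_mul_mul_comm, ← Complex.exp_add]
    congr 2
    push_cast
    ring
  have hgi : ∀ k l, IntervalIntegrable (g k l) MeasureTheory.volume A B := fun k l =>
    (Continuous.intervalIntegrable (by rw [hg]; fun_prop) A B)
  have hint : ((∫ t in A..B, ‖∑ k ∈ S, β k * (k : ℂ) ^ (-(t * Complex.I))‖ ^ 2 : ℝ) : ℂ) =
      ∑ k ∈ S, ∑ l ∈ S, ∫ t in A..B, g k l t := by
    rw [← intervalIntegral.integral_ofReal]
    simp only [hsq]
    have hgs : ∀ k ∈ S, IntervalIntegrable (fun t => ∑ l ∈ S, g k l t) MeasureTheory.volume A B :=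
      fun k _ => Continuous.intervalIntegrable (by simp only [hg]; fun_prop) A B
    rw [intervalIntegral.integral_finsetSum hgs]
    refine Finset.sum_congr rfl fun k _ => ?_
    rw [intervalIntegral.integral_finsetSum fun l _ => hgi k l]
  have hdiag : (((B - A) * ∑ k ∈ S, ‖β k‖ ^ 2 : ℝ) : ℂ) =
      ∑ k ∈ S, ∑ l ∈ S, if k = l then ∫ t in A..B, g k l t else 0 := by
    push_cast
    rw [Finset.mul_sum]
    refine Finset.sum_congr rfl fun k hk => ?_
    rw [Finset.sum_ite_eq, if_pos hk, hg]
    simp only [sub_self, Complex.ofReal_zero, zero_mul, Complex.exp_zero, mul_one]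
    rw [Complex.mul_conj', intervalIntegral.integral_const, Complex.real_smul]
    push_cast
    ring
  rw [← Real.norm_eq_abs, ← Complex.norm_real, Complex.ofReal_sub, hint, hdiag,
    ← Finset.sum_sub_distrib]
  refine norm_sum_le_of_le _ fun k hk => ?_
  rw [← Finset.sum_sub_distrib]
  refine norm_sum_le_of_le _ fun l hl => ?_
  split_ifs with h
  · simp only [sub_self, norm_zero]; positivity
  · rw [sub_zero, hg]
    simp only
    rw [intervalIntegral.integral_const_mul, norm_mul, norm_mul, RCLike.norm_conj]
    gcongr
    refine norm_integral_exp_le (sub_ne_zero.2 fun hlog => h ?_)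
    have hk' : (0 : ℝ) < k := by exact_mod_cast hS k hk
    have hl' : (0 : ℝ) < l := by exact_mod_cast hS l hl
    exact_mod_cast (Real.log_injOn_pos hl' hk' hlog).symm

lemma one_div_log_sub_log_le {k l : ℕ} (hk : 0 < k) (hkl : k < l) :
    1 / (Real.log l - Real.log k) ≤ (l : ℝ) / (l - k) := by
  have hk' : (0 : ℝ) < k := by exact_mod_cast hk
  have hl' : (0 : ℝ) < l := by exact_mod_cast hk.trans hkl
  have hkl' : (k : ℝ) < l := by exact_mod_cast hkl
  have h : ((l : ℝ) - k) / l ≤ Real.log l - Real.log k := by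
    have := Real.one_sub_inv_le_log_of_pos (x := (l : ℝ) / k) (by positivity)
    rw [Real.log_div hl'.ne' hk'.ne', inv_div] at this
    rw [sub_div, div_self hl'.ne']
    exact this
  have h0 : 0 < ((l : ℝ) - k) / l := div_pos (by linarith) hl'
  calc _ ≤ 1 / (((l : ℝ) - k) / l) := one_div_le_one_div_of_le h0 h
    _ = _ := by rw [one_div_div]

/-- After 1/log(l/k) ≤ l/(l - k) and k^{-α} ≤ l^{1-α}/k, the partial fraction l/(k(l - k)) = 1/k +
1/(l - k) treats near and distant pairs together. Each half sums over `k` to a harmonic sum. -/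
lemma rpow_mul_rpow_div_log_le {α : ℝ} (hα : α ≤ 1) {k l : ℕ} (hk : 0 < k) (hkl : k < l) :
    (k : ℝ) ^ (-α) * (l : ℝ) ^ (-α) * (2 / |Real.log l - Real.log k|) ≤
      2 * ((l : ℝ) ^ (1 - 2 * α) * ((k : ℝ)⁻¹ + ((l - k : ℕ) : ℝ)⁻¹)) := by
  have hk' : (0 : ℝ) < k := by exact_mod_cast hk
  have hl' : (0 : ℝ) < l := by exact_mod_cast hk.trans hkl
  have hkl' : (k : ℝ) < l := by exact_mod_cast hkl
  have hd : (0 : ℝ) < (l : ℝ) - k := by linarith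
  have hlog : 0 < Real.log l - Real.log k := sub_pos.2 (Real.log_lt_log hk' hkl')
  rw [abs_of_pos hlog, Nat.cast_sub hkl.le]
  have h1 := one_div_log_sub_log_le hk hkl
  have h2 : (k : ℝ) ^ (-α) ≤ (l : ℝ) ^ (1 - α) * (k : ℝ)⁻¹ := by
    have : -α = (1 - α) + -1 := by ring
    rw [this, Real.rpow_add hk', Real.rpow_neg_one]
    gcongr
  have e : (l : ℝ) ^ (1 - 2 * α) * l = (l : ℝ) ^ (1 - α) * (l : ℝ) ^ (-α) * l := by
    rw [← Real.rpow_add hl']; congr 2; ring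
  calc _ = 2 * ((k : ℝ) ^ (-α) * (l : ℝ) ^ (-α) * (1 / (Real.log l - Real.log k))) := by ring
    _ ≤ 2 * (((l : ℝ) ^ (1 - α) * (k : ℝ)⁻¹) * (l : ℝ) ^ (-α) * ((l : ℝ) / (l - k))) := by gcongr
    _ = 2 * ((l : ℝ) ^ (1 - α) * (l : ℝ) ^ (-α) * l * ((k : ℝ)⁻¹ * ((l : ℝ) - k)⁻¹)) := by
        rw [div_eq_mul_inv]; ring
    _ = _ := by
        rw [← e]
        field_simp
        ring

/-- Induction by Bernoulli's inequality, (1 - 1/(N+1))^p ≤ 1 - p/(N+1) for 0 < p ≤ 1. -/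
lemma sum_rpow_le {p : ℝ} (hp0 : 0 < p) (hp1 : p ≤ 1) (N : ℕ) :
    ∑ l ∈ Finset.Ico 1 (N + 1), (l : ℝ) ^ (p - 1) ≤ (N : ℝ) ^ p / p := by
  induction N with
  | zero => simp; positivity
  | succ N ih =>
    rw [Finset.sum_Ico_succ_top (by omega)]
    have hN : (0 : ℝ) < ((N + 1 : ℕ) : ℝ) := by positivity
    have h := rpow_one_add_le_one_add_mul_self (s := -((N + 1 : ℕ) : ℝ)⁻¹) (p := p) (by
      rw [neg_le_neg_iff]
      exact inv_le_one_of_one_le₀ (by exact_mod_cast (by omega : 1 ≤ N + 1))) hp0.le hp1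
    have e : 1 + -((N + 1 : ℕ) : ℝ)⁻¹ = (N : ℝ) / ((N + 1 : ℕ) : ℝ) := by
      push_cast; field_simp; ring
    rw [e, Real.div_rpow (by positivity) hN.le, div_le_iff₀ (by positivity)] at h
    rw [Real.rpow_sub_one hN.ne']
    refine (add_le_add ih le_rfl).trans ?_
    rw [div_add' _ _ _ hp0.ne']
    gcongr
    refine (add_le_add h le_rfl).trans (le_of_eq ?_)
    field_simp
    ring

lemma sum_inv_add_inv_le {l N : ℕ} (hl : l ≤ N) :
    ∑ k ∈ Finset.Ico 1 l, ((k : ℝ)⁻¹ + ((l - k : ℕ) : ℝ)⁻¹) ≤ 2 * (1 + Real.log N) := by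
  have h1 : ∑ k ∈ Finset.Ico 1 l, (k : ℝ)⁻¹ ≤ 1 + Real.log N := by
    have h := harmonic_le_one_add_log N
    rw [harmonic_eq_sum_Icc] at h
    push_cast at h
    refine le_trans (Finset.sum_le_sum_of_subset_of_nonneg ?_ fun _ _ _ => by positivity) h
    intro k hk
    rw [Finset.mem_Ico] at hk
    rw [Finset.mem_Icc]
    omega
  have h2 : ∑ k ∈ Finset.Ico 1 l, ((l - k : ℕ) : ℝ)⁻¹ = ∑ k ∈ Finset.Ico 1 l, (k : ℝ)⁻¹ := by
    refine Finset.sum_nbij' (fun k => l - k) (fun k => l - k) ?_ ?_ ?_ ?_ ?_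
    all_goals intro k hk; simp only [Finset.mem_Ico] at hk ⊢
    all_goals omega
  rw [Finset.sum_add_distrib, h2]
  linarith

lemma sum_sum_rpow_div_log_le {α : ℝ} (hα0 : 1 / 2 < α) (hα1 : α < 1) (N : ℕ) :
    ∑ k ∈ Finset.Ico 1 (N + 1), ∑ l ∈ Finset.Ico 1 (N + 1),
      (k : ℝ) ^ (-α) * (l : ℝ) ^ (-α) * (2 / |Real.log l - Real.log k|) ≤
      8 / (2 - 2 * α) * ((N : ℝ) ^ (2 - 2 * α) * (1 + Real.log N)) := by
  set h : ℕ → ℕ → ℝ := fun k l =>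
    if k < l then 2 * ((l : ℝ) ^ (1 - 2 * α) * ((k : ℝ)⁻¹ + ((l - k : ℕ) : ℝ)⁻¹)) else 0 with hh
  have hpt : ∀ k ∈ Finset.Ico 1 (N + 1), ∀ l ∈ Finset.Ico 1 (N + 1),
      (k : ℝ) ^ (-α) * (l : ℝ) ^ (-α) * (2 / |Real.log l - Real.log k|) ≤ h k l + h l k := by
    intro k hk l hl
    rw [Finset.mem_Ico] at hk hl
    simp only [hh]
    rcases lt_trichotomy k l with hkl | rfl | hkl
    · rw [if_pos hkl, if_neg (by omega), add_zero]
      exact rpow_mul_rpow_div_log_le hα1.le (by omega) hkl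
    -- On the diagonal log l - log k = 0, and division by zero makes the left side 0.
    · simp
    · rw [if_pos hkl, if_neg (by omega), zero_add, abs_sub_comm, mul_comm ((k : ℝ) ^ (-α))]
      exact rpow_mul_rpow_div_log_le hα1.le (by omega) hkl
  have hlogN : 0 ≤ Real.log N := Real.log_natCast_nonneg N
  have hsum : ∑ l ∈ Finset.Ico 1 (N + 1), ∑ k ∈ Finset.Ico 1 (N + 1), h k l ≤
      4 / (2 - 2 * α) * ((N : ℝ) ^ (2 - 2 * α) * (1 + Real.log N)) := by
    have hl : ∀ l ∈ Finset.Ico 1 (N + 1), ∑ k ∈ Finset.Ico 1 (N + 1), h k l ≤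
        4 * (1 + Real.log N) * (l : ℝ) ^ ((2 - 2 * α) - 1) := by
      intro l hl
      rw [Finset.mem_Ico] at hl
      have e : ∑ k ∈ Finset.Ico 1 (N + 1), h k l = ∑ k ∈ Finset.Ico 1 l,
          2 * ((l : ℝ) ^ (1 - 2 * α) * ((k : ℝ)⁻¹ + ((l - k : ℕ) : ℝ)⁻¹)) := by
        simp only [hh]
        rw [← Finset.sum_filter]
        refine Finset.sum_congr ?_ fun _ _ => rfl
        ext k
        simp only [Finset.mem_filter, Finset.mem_Ico]
        omega
      rw [e, ← Finset.mul_sum, ← Finset.mul_sum]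
      have := sum_inv_add_inv_le (l := l) (N := N) (by omega)
      have e2 : 2 - 2 * α - 1 = 1 - 2 * α := by ring
      rw [e2]
      calc _ ≤ 2 * ((l : ℝ) ^ (1 - 2 * α) * (2 * (1 + Real.log N))) := by gcongr
        _ = _ := by ring
    refine (Finset.sum_le_sum hl).trans ?_
    rw [← Finset.mul_sum]
    have := sum_rpow_le (p := 2 - 2 * α) (by linarith) (by linarith) N
    calc _ ≤ 4 * (1 + Real.log N) * ((N : ℝ) ^ (2 - 2 * α) / (2 - 2 * α)) := by gcongr
      _ = _ := by ring
  refine (Finset.sum_le_sum fun k hk => Finset.sum_le_sum fun l hl => hpt k hk l hl).trans ?_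
  simp only [Finset.sum_add_distrib]
  have hc := Finset.sum_comm (s := Finset.Ico 1 (N + 1)) (t := Finset.Ico 1 (N + 1)) (f := h)
  rw [hc]
  calc _ ≤ 4 / (2 - 2 * α) * ((N : ℝ) ^ (2 - 2 * α) * (1 + Real.log N)) +
        4 / (2 - 2 * α) * ((N : ℝ) ^ (2 - 2 * α) * (1 + Real.log N)) := add_le_add hsum hsum
    _ = _ := by ring

lemma abs_integral_norm_sq_dirichlet_sub_le_of_norm_le {β : ℕ → ℂ} {α A : ℝ} (hα0 : 1 / 2 < α)
    (hα1 : α < 1) (hA : 0 ≤ A) (hβ : ∀ k, ‖β k‖ ≤ A * (k : ℝ) ^ (-α)) (N : ℕ) (U V : ℝ) :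
    |(∫ t in U..V, ‖∑ k ∈ Finset.Ico 1 (N + 1), β k * (k : ℂ) ^ (-(t * Complex.I))‖ ^ 2) -
        (V - U) * ∑ k ∈ Finset.Ico 1 (N + 1), ‖β k‖ ^ 2| ≤
      A ^ 2 * (8 / (2 - 2 * α)) * ((N : ℝ) ^ (2 - 2 * α) * (1 + Real.log N)) := by
  refine (abs_integral_norm_sq_dirichlet_sub_le β _ (fun k hk => (Finset.mem_Ico.1 hk).1) U V).trans ?_
  rw [mul_assoc]
  refine le_trans ?_ (mul_le_mul_of_nonneg_left (sum_sum_rpow_div_log_le hα0 hα1 N) (sq_nonneg A))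
  rw [Finset.mul_sum]
  refine Finset.sum_le_sum fun k _ => ?_
  rw [Finset.mul_sum]
  refine Finset.sum_le_sum fun l _ => ?_
  calc _ ≤ (A * (k : ℝ) ^ (-α)) * (A * (l : ℝ) ^ (-α)) * (2 / |Real.log l - Real.log k|) := by
        gcongr
        · exact hβ k
        · exact hβ l
    _ = _ := by ring

/-- Summing an asymptotic formula over dyadic intervals. -/
lemma isBigO_integral_sub_of_dyadic {f : ℝ → ℝ} {S θ C T₁ : ℝ} (hf : ∀ t, 0 ≤ f t)
    (hint : ∀ T, 2 ≤ T → IntervalIntegrable f MeasureTheory.volume 2 T) (hθ : 0 < θ) (hC : 0 ≤ C)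
    (hT₁ : 3 ≤ T₁) (h : ∀ T ≥ T₁, |(∫ t in T..(2 * T), f t) - T * S| ≤ C * (T ^ θ * Real.log T)) :
    (fun T : ℝ => (∫ t in (2 : ℝ)..T, f t) - S * T) =O[atTop] fun T => T ^ θ * Real.log T := by
  set F : ℝ → ℝ := fun T => (∫ t in (2 : ℝ)..T, f t) - S * T with hF
  set K₀ := (∫ t in (2 : ℝ)..(2 * T₁), f t) + |S| * (2 * T₁) with hK₀
  have hK₀0 : 0 ≤ K₀ := add_nonneg (intervalIntegral.integral_nonneg (by linarith) fun t _ => hf t)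
    (by positivity)
  have h2θ : 0 < (2 : ℝ) ^ θ - 1 := sub_pos.2 (Real.one_lt_rpow (by norm_num) hθ)
  -- Chosen so that K + C ≤ 2^θ K: passing from T/2 to T costs `C`, and the growth of T^θ pays for
  -- it.
  set K := K₀ + C / (2 ^ θ - 1) with hK
  have hKC : K + C ≤ 2 ^ θ * K := by
    have : C ≤ K * (2 ^ θ - 1) := by
      rw [hK, add_mul, div_mul_cancel₀ _ h2θ.ne']
      have := mul_nonneg hK₀0 h2θ.le
      linarith
    linarith
  have hlog : ∀ T ≥ T₁, 1 ≤ Real.log T := fun T hT => by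
    rw [Real.le_log_iff_exp_le (by linarith)]
    linarith [Real.exp_one_lt_d9]
  have hpow : ∀ T ≥ T₁, 1 ≤ T ^ θ := fun T hT => Real.one_le_rpow (by linarith) hθ.le
  have key : ∀ n : ℕ, ∀ T, T₁ ≤ T → T ≤ 2 ^ n * (2 * T₁) → |F T| ≤ K * (T ^ θ * Real.log T) := by
    intro n
    have base : ∀ T, T₁ ≤ T → T ≤ 2 * T₁ → |F T| ≤ K * (T ^ θ * Real.log T) := by
      intro T hT hT2
      have h1 : |F T| ≤ K₀ := by
        rw [hF]
        refine (abs_sub _ _).trans (add_le_add ?_ ?_)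
        · rw [abs_of_nonneg (intervalIntegral.integral_nonneg (by linarith) fun t _ => hf t)]
          exact intervalIntegral.integral_mono_interval le_rfl (by linarith) hT2
            (Eventually.of_forall hf) (hint _ (by linarith))
        · rw [abs_mul, abs_of_nonneg (by linarith : 0 ≤ T)]
          gcongr
      have h2 : K₀ ≤ K := by
        have : 0 ≤ C / (2 ^ θ - 1) := by positivity
        linarith
      have h3 : 1 ≤ T ^ θ * Real.log T := one_le_mul_of_one_le_of_one_le (hpow T hT) (hlog T hT)
      nlinarith
    induction n with
    | zero => simpa using base
    | succ n ih =>
      intro T hT hTn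
      by_cases hT2 : T ≤ 2 * T₁
      · exact base T hT hT2
      push Not at hT2
      have hh : T₁ ≤ T / 2 := by linarith
      have h1 := ih (T / 2) hh (by rw [pow_succ] at hTn; linarith)
      have h2 := h (T / 2) hh
      have e : F T = F (T / 2) + ((∫ t in (T / 2)..(2 * (T / 2)), f t) - T / 2 * S) := by
        have e1 : 2 * (T / 2) = T := by ring
        rw [e1, hF]
        simp only
        rw [← intervalIntegral.integral_add_adjacent_intervals (hint (T / 2) (by linarith))
          ((hint (T / 2) (by linarith)).symm.trans (hint T (by linarith)))]
        ring
      have hT0 : 0 ≤ T := by linarith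
      have h3 : (T / 2) ^ θ * Real.log (T / 2) ≤ (2 ^ θ)⁻¹ * (T ^ θ * Real.log T) := by
        rw [Real.div_rpow hT0 (by norm_num), div_eq_inv_mul, mul_assoc]
        gcongr
        · linarith
        · linarith
      have hK0 : 0 ≤ K := by positivity
      rw [e]
      calc _ ≤ _ := abs_add_le _ _
        _ ≤ (K + C) * ((T / 2) ^ θ * Real.log (T / 2)) := by rw [add_mul]; exact add_le_add h1 h2
        _ ≤ (K + C) * ((2 ^ θ)⁻¹ * (T ^ θ * Real.log T)) := by gcongr
        _ ≤ (2 ^ θ * K) * ((2 ^ θ)⁻¹ * (T ^ θ * Real.log T)) := by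
            have := hlog T hT
            gcongr
        _ = K * (T ^ θ * Real.log T) := by field_simp
  refine IsBigO.of_bound K ?_
  filter_upwards [eventually_ge_atTop T₁] with T hT
  obtain ⟨n, hn⟩ := pow_unbounded_of_one_lt T (by norm_num : (1 : ℝ) < 2)
  have h1 := key n T hT (hn.le.trans (le_mul_of_one_le_right (by positivity) (by linarith)))
  have : 0 ≤ T ^ θ * Real.log T := by
    have := hlog T hT
    have := hpow T hT
    positivity
  rwa [Real.norm_eq_abs, Real.norm_of_nonneg this]

/-! ### The mean square on the line Re s₃ = σ₃. -/

noncomputable section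

/-- The coefficient of `k^{-it}` in the Apostol-Vu series on the line `Re s₃ = σ₃`. -/
def avLineCoeff (s₁ s₂ : ℂ) (σ₃ : ℝ) (k : ℕ) : ℂ := avCoeff s₁ s₂ k * (k : ℂ) ^ (-(σ₃ : ℂ))

end

lemma avCoeff_zero (s₁ s₂ : ℂ) : avCoeff s₁ s₂ 0 = 0 := by simp [avCoeff]

lemma norm_avLineCoeff (s₁ s₂ : ℂ) (σ₃ : ℝ) (k : ℕ) :
    ‖avLineCoeff s₁ s₂ σ₃ k‖ = ‖avCoeff s₁ s₂ k‖ * (k : ℝ) ^ (-σ₃) := by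
  rcases k.eq_zero_or_pos with rfl | hk
  · simp [avLineCoeff, avCoeff_zero]
  · rw [avLineCoeff, norm_mul, norm_natCast_cpow_neg hk, Complex.ofReal_re]

lemma avSquareTerm_eq (s₁ s₂ : ℂ) (σ₃ : ℝ) (k : ℕ) :
    avSquareTerm s₁ s₂ ((2 * σ₃ : ℝ) : ℂ) k = ((‖avLineCoeff s₁ s₂ σ₃ k‖ ^ 2 : ℝ) : ℂ) := by
  have e : avSquareTerm s₁ s₂ ((2 * σ₃ : ℝ) : ℂ) k =
    ((‖avCoeff s₁ s₂ k‖ ^ 2 : ℝ) : ℂ) * (1 / (k : ℂ) ^ ((2 * σ₃ : ℝ) : ℂ)) := rfl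
  rw [e, norm_avLineCoeff]
  rcases k.eq_zero_or_pos with rfl | hk
  · simp [avCoeff_zero]
  have hk' : (0 : ℝ) ≤ k := by positivity
  rw [← Complex.ofReal_natCast, ← Complex.ofReal_cpow hk', mul_pow, ← Real.rpow_mul_natCast hk',
    show -σ₃ * ((2 : ℕ) : ℝ) = -(2 * σ₃) by push_cast; ring, Real.rpow_neg hk']
  push_cast
  ring

lemma avPartial_line (M : ℕ) (s₁ s₂ : ℂ) (σ₃ t : ℝ) :
    avPartial M (s₁, s₂, (σ₃ : ℂ) + t * Complex.I) =
      ∑ k ∈ Finset.Ico 1 (2 * M + 1), avLineCoeff s₁ s₂ σ₃ k * (k : ℂ) ^ (-(t * Complex.I)) := by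
  rw [avPartial, Finset.range_eq_Ico, Finset.sum_eq_sum_Ico_succ_bot (by omega)]
  simp only [avCoeff_zero, zero_mul, zero_add]
  refine Finset.sum_congr rfl fun k hk => ?_
  have hk0 : (k : ℂ) ≠ 0 := by
    have := (Finset.mem_Ico.1 hk).1
    exact_mod_cast (by omega : k ≠ 0)
  rw [avLineCoeff, one_div, ← Complex.cpow_neg, neg_add, Complex.cpow_add _ _ hk0]
  ring

lemma line_mem_avDomain_one {s₁ s₂ : ℂ} {σ₃ t : ℝ} (h₁₃ : 0 < s₁.re + σ₃)
    (hlow : 1 < s₁.re + s₂.re + σ₃)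
    (h : s₁ + ((σ₃ : ℂ) + t * Complex.I) ≠ 1 ∧ s₁ + s₂ + ((σ₃ : ℂ) + t * Complex.I) ≠ 2) :
    (s₁, s₂, (σ₃ : ℂ) + t * Complex.I) ∈ avDomain 1 :=
  mem_avDomain_one.2 ⟨by simpa using h₁₃, by simpa using hlow, h.1, h.2⟩

lemma continuousOn_avZeta_line {s₁ s₂ : ℂ} {σ₃ : ℝ} (h₁₃ : 0 < s₁.re + σ₃)
    (hlow : 1 < s₁.re + s₂.re + σ₃)
    (havoid : ∀ t : ℝ, 2 ≤ t →
      s₁ + ((σ₃ : ℂ) + t * Complex.I) ≠ 1 ∧ s₁ + s₂ + ((σ₃ : ℂ) + t * Complex.I) ≠ 2) :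
    ContinuousOn (fun t : ℝ => avZeta s₁ s₂ ((σ₃ : ℂ) + t * Complex.I)) (Set.Ici 2) := by
  have hmem : Set.MapsTo (fun t : ℝ => (s₁, s₂, (σ₃ : ℂ) + t * Complex.I)) (Set.Ici 2)
      (avDomain 1) := fun t ht => line_mem_avDomain_one h₁₃ hlow (havoid t ht)
  have hc : ContinuousOn (fun p => avPartial 1 p + avRest 1 p) (avDomain 1) :=
    (isAVContinuation_avPartial_add_avRest one_pos).1.continuousOn
  exact (hc.comp (Continuous.continuousOn (by fun_prop)) hmem).congr
    fun t ht => avZeta_eq one_pos (hmem ht)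

lemma intervalIntegrable_norm_avZeta_sq {s₁ s₂ : ℂ} {σ₃ : ℝ} (h₁₃ : 0 < s₁.re + σ₃)
    (hlow : 1 < s₁.re + s₂.re + σ₃)
    (havoid : ∀ t : ℝ, 2 ≤ t →
      s₁ + ((σ₃ : ℂ) + t * Complex.I) ≠ 1 ∧ s₁ + s₂ + ((σ₃ : ℂ) + t * Complex.I) ≠ 2)
    {A B : ℝ} (hA : 2 ≤ A) (hAB : A ≤ B) : IntervalIntegrable
      (fun t : ℝ => ‖avZeta s₁ s₂ ((σ₃ : ℂ) + t * Complex.I)‖ ^ 2) MeasureTheory.volume A B := by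
  refine ContinuousOn.intervalIntegrable
    (((continuousOn_avZeta_line h₁₃ hlow havoid).mono ?_).norm.pow 2)
  rw [Set.uIcc_of_le hAB]
  exact fun t ht => hA.trans ht.1

/-- The cross term 2ε‖P‖ is at most ε(‖P‖² + 1), so the known mean square of `P` suffices and no
Cauchy-Schwarz step for integrals is needed. -/
lemma abs_norm_add_sq_sub_le {P E : ℂ} {ε : ℝ} (hE : ‖E‖ ≤ ε) :
    |‖P + E‖ ^ 2 - ‖P‖ ^ 2| ≤ ε * ‖P‖ ^ 2 + ε * (1 + ε) := by
  have h1 := norm_add_le P E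
  have h2 : ‖P‖ ≤ ‖P + E‖ + ‖E‖ := by simpa using norm_sub_le (P + E) E
  have hε : 0 ≤ ε := (norm_nonneg _).trans hE
  have h3 : |‖P + E‖ - ‖P‖| ≤ ε := abs_le.2 ⟨by linarith, by linarith⟩
  have e : ‖P + E‖ ^ 2 - ‖P‖ ^ 2 = (‖P + E‖ - ‖P‖) * (‖P + E‖ + ‖P‖) := by ring
  rw [e, abs_mul, abs_of_nonneg (by positivity : 0 ≤ ‖P + E‖ + ‖P‖)]
  have h4 : ‖P + E‖ + ‖P‖ ≤ 2 * ‖P‖ + ε := by linarith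
  calc _ ≤ ε * (2 * ‖P‖ + ε) := by gcongr
    _ ≤ _ := by nlinarith [sq_nonneg (‖P‖ - 1)]

lemma abs_tsum_sub_sum_le {r : ℕ → ℝ} {α A : ℝ} (hα : 1 / 2 < α) (h0 : r 0 = 0)
    (hr0 : ∀ k, 0 ≤ r k) (hr : ∀ k, r k ≤ A * (k : ℝ) ^ (-(2 * α))) {N : ℕ} :
    Summable r ∧ |∑ k ∈ Finset.Ico 1 (N + 1), r k - ∑' k, r k| ≤
      A * (1 + 1 / (2 * α - 1)) * ((N + 1 : ℕ) : ℝ) ^ (-(2 * α - 1)) := by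
  have hs : Summable r := Summable.of_nonneg_of_le hr0 hr
    ((Real.summable_nat_rpow.2 (by linarith)).mul_left A)
  refine ⟨hs, ?_⟩
  have e : ∑ k ∈ Finset.Ico 1 (N + 1), r k = ∑ k ∈ Finset.range (N + 1), r k := by
    symm
    rw [Finset.range_eq_Ico, Finset.sum_eq_sum_Ico_succ_bot N.succ_pos, h0, zero_add]
  rw [e, ← hs.sum_add_tsum_nat_add (N + 1), sub_add_cancel_left, abs_neg,
    abs_of_nonneg (tsum_nonneg fun k => hr0 _)]
  have hA : 0 ≤ A := by simpa using (hr0 1).trans (hr 1)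
  have h1 : ∑' k, r (k + (N + 1)) ≤
      ∑' k : ℕ, A * ((N + 1 + k : ℕ) : ℝ) ^ (-(2 * α - 1) - 1) := by
    simp only [add_comm _ (N + 1)]
    refine Summable.tsum_le_tsum (fun k => ?_) (((summable_nat_add_iff (N + 1)).2 hs).congr fun k => by rw [add_comm])
      ((summable_rpow_add (by linarith) (N + 1)).mul_left A)
    have := hr (N + 1 + k)
    rwa [show -(2 * α) = -(2 * α - 1) - 1 by ring] at this
  refine h1.trans ?_
  rw [tsum_mul_left, mul_assoc]
  gcongr
  exact tsum_rpow_add_le (by linarith) (by omega)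

/-- On [T, 2T] one Dirichlet polynomial of length ≍ T serves all heights. Three errors are
collected: the off-diagonal terms, the tail of the diagonal series, and the pointwise O(T^{-α}) from
`avRest`. -/
lemma exists_dyadic_mean_square (s₁ s₂ : ℂ) {σ₃ α : ℝ} (hσ₁ : 0 ≤ s₁.re)
    (hα0 : 1 / 2 < α) (hα1 : α < 1) (ha : α ≤ s₁.re + σ₃) (hb : α < s₁.re + s₂.re + σ₃ - 1)
    (havoid : ∀ t : ℝ, 2 ≤ t →
      s₁ + ((σ₃ : ℂ) + t * Complex.I) ≠ 1 ∧ s₁ + s₂ + ((σ₃ : ℂ) + t * Complex.I) ≠ 2) :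
    Summable (fun k => ‖avLineCoeff s₁ s₂ σ₃ k‖ ^ 2) ∧
    ∃ C ≥ (0 : ℝ), ∃ T₁ ≥ (3 : ℝ), ∀ T ≥ T₁,
      |(∫ t in T..(2 * T), ‖avZeta s₁ s₂ ((σ₃ : ℂ) + t * Complex.I)‖ ^ 2) -
        T * ∑' k, ‖avLineCoeff s₁ s₂ σ₃ k‖ ^ 2| ≤ C * (T ^ (2 - 2 * α) * Real.log T) := by
  obtain ⟨A, hA0, hA⟩ := exists_norm_avCoeff_le (s₂ := s₂) hσ₁ ha hb
  obtain ⟨C, hC1, hE⟩ := exists_norm_avRest_le s₁ s₂ (α := α) (by linarith) ha hb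
  obtain ⟨E, hE0, T₀, hE⟩ := hE (3 * C) (by linarith)
  set β := avLineCoeff s₁ s₂ σ₃ with hβ
  have hβA : ∀ k, ‖β k‖ ≤ A * (k : ℝ) ^ (-α) := fun k => by
    rw [hβ, norm_avLineCoeff]; exact hA k
  have hβ0 : ‖β 0‖ ^ 2 = 0 := by simp [hβ, avLineCoeff, avCoeff_zero]
  have hβ2 : ∀ k, ‖β k‖ ^ 2 ≤ A ^ 2 * (k : ℝ) ^ (-(2 * α)) := fun k => by
    have hk : (0 : ℝ) ≤ k := by positivity
    calc _ ≤ (A * (k : ℝ) ^ (-α)) ^ 2 := by gcongr; exact hβA k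
      _ = _ := by
        rw [mul_pow, ← Real.rpow_mul_natCast hk]
        congr 2
        push_cast; ring
  have htail := fun N : ℕ => abs_tsum_sub_sum_le (N := N) hα0 hβ0 (fun k => sq_nonneg ‖β k‖) hβ2
  refine ⟨(htail 0).1, ?_⟩
  set S := ∑' k, ‖β k‖ ^ 2 with hS
  have hS0 : 0 ≤ S := tsum_nonneg fun k => sq_nonneg _
  set θ := 2 - 2 * α with hθ
  have hθ0 : 0 < θ := by linarith
  have h8C : 1 ≤ 8 * C := by linarith
  have hl8C : 0 ≤ Real.log (8 * C) := Real.log_nonneg h8C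
  have h1α : 0 < 2 * α - 1 := by linarith
  set D₁ := A ^ 2 * (8 / θ) * ((8 * C) ^ θ * (2 + Real.log (8 * C))) with hD₁
  have hD₁0 : 0 ≤ D₁ := by positivity
  set D₂ := A ^ 2 * (1 + 1 / (2 * α - 1)) with hD₂
  have hD₂0 : 0 ≤ D₂ := by positivity
  refine ⟨(D₁ + D₂) + E * (S + D₁ + D₂) + E * (1 + E), by positivity, max 3 T₀, le_max_left _ _,
    fun T hT => ?_⟩
  have hT3 : 3 ≤ T := (le_max_left _ _).trans hT
  have hTT₀ : T₀ ≤ T := (le_max_right _ _).trans hT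
  have hTpos : 0 < T := by linarith
  have hlogT : 1 ≤ Real.log T := by
    rw [Real.le_log_iff_exp_le hTpos]
    linarith [Real.exp_one_lt_d9]
  have hTθ : 0 < T ^ θ := by positivity
  set g := T ^ θ * Real.log T with hg
  -- For every t in [T, 2T] this gives Ct ≤ 2CT ≤ M ≤ 3CT ≤ 3Ct, which explains the earlier choice D
  -- = 3C; the length 2M stays below 8CT.
  set M := ⌈2 * C * T⌉₊ with hM
  have hMl : 2 * C * T ≤ M := Nat.le_ceil _
  have hMu : (M : ℝ) < 2 * C * T + 1 := Nat.ceil_lt_add_one (by positivity)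
  have hCT : T ≤ C * T := le_mul_of_one_le_left hTpos.le hC1
  have hMpos : (0 : ℝ) < M := by linarith
  have hMn : 0 < M := by exact_mod_cast hMpos
  have hTM : T ≤ M := by linarith
  set P : ℝ → ℂ := fun t => ∑ k ∈ Finset.Ico 1 (2 * M + 1), β k * (k : ℂ) ^ (-(t * Complex.I)) with hP
  have hPc : Continuous P := by
    refine continuous_finsetSum _ fun k hk => ?_
    have hk0 : 0 < k := (Finset.mem_Ico.1 hk).1
    simp only [natCast_cpow_neg_mul_I hk0]
    fun_prop
  have hPint : IntervalIntegrable (fun t => ‖P t‖ ^ 2) MeasureTheory.volume T (2 * T) :=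
    (hPc.norm.pow 2).intervalIntegrable _ _
  have hZint := intervalIntegrable_norm_avZeta_sq (by linarith) (by linarith) havoid
    (show 2 ≤ T by linarith) (show T ≤ 2 * T by linarith)
  set ε := E * T ^ (-α) with hε
  have hε0 : 0 ≤ ε := by positivity
  have hεE : ε ≤ E := mul_le_of_le_one_right hE0
    (Real.rpow_le_one_of_one_le_of_nonpos (by linarith) (by linarith))
  have hpt : ∀ t ∈ Set.Ioc T (2 * T),
      ‖‖avZeta s₁ s₂ ((σ₃ : ℂ) + t * Complex.I)‖ ^ 2 - ‖P t‖ ^ 2‖ ≤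
        ε * ‖P t‖ ^ 2 + ε * (1 + ε) := by
    intro t ht
    have htT : T ≤ t := ht.1.le
    have htC : C * t ≤ C * (2 * T) := by have := ht.2; gcongr
    rw [avZeta_eq hMn (line_mem_avDomain_one (by linarith) (by linarith)
      (havoid t (by linarith))), avPartial_line, Real.norm_eq_abs]
    refine abs_norm_add_sq_sub_le ((hE t (by linarith) M (by linarith) ?_).trans ?_)
    · have : 3 * C * T ≤ 3 * C * t := by gcongr
      linarith
    · rw [hε]
      have : (M : ℝ) ^ (-α) ≤ T ^ (-α) := Real.rpow_le_rpow_of_nonpos hTpos hTM (by linarith)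
      gcongr
  have hdiff : |(∫ t in T..(2 * T), ‖avZeta s₁ s₂ ((σ₃ : ℂ) + t * Complex.I)‖ ^ 2) -
      ∫ t in T..(2 * T), ‖P t‖ ^ 2| ≤ ε * (∫ t in T..(2 * T), ‖P t‖ ^ 2) + ε * (1 + ε) * T := by
    rw [← intervalIntegral.integral_sub hZint hPint, ← Real.norm_eq_abs]
    refine (intervalIntegral.norm_integral_le_of_norm_le (by linarith)
      (Eventually.of_forall hpt) ((hPint.const_mul ε).add (by simp))).trans (le_of_eq ?_)
    rw [intervalIntegral.integral_add (hPint.const_mul ε) (by simp),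
      intervalIntegral.integral_const_mul, intervalIntegral.integral_const, smul_eq_mul]
    ring
  have hmv := abs_integral_norm_sq_dirichlet_sub_le_of_norm_le hα0 hα1 hA0 hβA (2 * M) T (2 * T)
  have hN8 : ((2 * M : ℕ) : ℝ) ≤ 8 * C * T := by push_cast; linarith
  have hNpos : (0 : ℝ) < ((2 * M : ℕ) : ℝ) := by push_cast; linarith
  have hmv' : A ^ 2 * (8 / (2 - 2 * α)) * (((2 * M : ℕ) : ℝ) ^ (2 - 2 * α) *
      (1 + Real.log ((2 * M : ℕ) : ℝ))) ≤ D₁ * g := by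
    rw [← hθ]
    have h1 : ((2 * M : ℕ) : ℝ) ^ θ ≤ (8 * C) ^ θ * T ^ θ := by
      rw [← Real.mul_rpow (by linarith) hTpos.le]
      gcongr
    have h2 : Real.log ((2 * M : ℕ) : ℝ) ≤ Real.log (8 * C) + Real.log T := by
      rw [← Real.log_mul (by linarith) hTpos.ne']
      exact Real.log_le_log hNpos hN8
    have h3 : 1 + Real.log ((2 * M : ℕ) : ℝ) ≤ (2 + Real.log (8 * C)) * Real.log T := by
      nlinarith
    have h4 : 0 ≤ 1 + Real.log ((2 * M : ℕ) : ℝ) := by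
      have := Real.log_natCast_nonneg (2 * M)
      linarith
    calc _ ≤ A ^ 2 * (8 / θ) * (((8 * C) ^ θ * T ^ θ) * ((2 + Real.log (8 * C)) * Real.log T)) := by
          gcongr
      _ = _ := by rw [hD₁, hg]; ring
  have hTα : T * T ^ (-(2 * α - 1)) = T ^ θ := by
    nth_rewrite 1 [← Real.rpow_one T]
    rw [← Real.rpow_add hTpos]
    congr 1
    rw [hθ]; ring
  have hgT : T ^ θ ≤ g := le_mul_of_one_le_right hTθ.le hlogT
  have hdir : |T * (∑ k ∈ Finset.Ico 1 (2 * M + 1), ‖β k‖ ^ 2) - T * S| ≤ D₂ * g := by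
    rw [← mul_sub, abs_mul, abs_of_pos hTpos]
    have h1 := (htail (2 * M)).2
    have h2 : ((2 * M + 1 : ℕ) : ℝ) ^ (-(2 * α - 1)) ≤ T ^ (-(2 * α - 1)) :=
      Real.rpow_le_rpow_of_nonpos hTpos (by push_cast; linarith) (by linarith)
    calc _ ≤ T * (D₂ * T ^ (-(2 * α - 1))) := by
          gcongr
          exact h1.trans (by gcongr)
      _ = D₂ * T ^ θ := by rw [← hTα]; ring
      _ ≤ _ := by gcongr
  have hPS : |(∫ t in T..(2 * T), ‖P t‖ ^ 2) - T * S| ≤ (D₁ + D₂) * g := by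
    have h1 := hmv.trans hmv'
    rw [show 2 * T - T = T by ring] at h1
    calc _ ≤ _ := abs_sub_le _ (T * ∑ k ∈ Finset.Ico 1 (2 * M + 1), ‖β k‖ ^ 2) _
      _ ≤ D₁ * g + D₂ * g := add_le_add h1 hdir
      _ = _ := by ring
  have hg0 : 0 ≤ g := hTθ.le.trans hgT
  -- The pointwise error integrates to T^{1-α}, which is at most T^{2-2α} because α < 1.
  have hεT : ε * T ≤ E * g := by
    have h1 : T ^ (-α) * T ≤ T ^ θ := by
      nth_rewrite 2 [← Real.rpow_one T]
      rw [← Real.rpow_add hTpos]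
      exact Real.rpow_le_rpow_of_exponent_le (by linarith) (by rw [hθ]; linarith)
    calc ε * T = E * (T ^ (-α) * T) := by rw [hε]; ring
      _ ≤ E * g := by gcongr; exact h1.trans hgT
  have hPu : ∫ t in T..(2 * T), ‖P t‖ ^ 2 ≤ T * S + (D₁ + D₂) * g := by
    have := (abs_le.1 hPS).2
    linarith
  have hεP : ε * (∫ t in T..(2 * T), ‖P t‖ ^ 2) ≤ E * (S + D₁ + D₂) * g := by
    calc _ ≤ ε * (T * S + (D₁ + D₂) * g) := by gcongr
      _ = (ε * T) * S + ε * ((D₁ + D₂) * g) := by ring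
      _ ≤ (E * g) * S + E * ((D₁ + D₂) * g) := by gcongr
      _ = _ := by ring
  have hεε : ε * (1 + ε) * T ≤ E * (1 + E) * g := by
    calc _ = (ε * T) * (1 + ε) := by ring
      _ ≤ (E * g) * (1 + E) := by gcongr
      _ = _ := by ring
  calc _ ≤ _ := abs_sub_le _ (∫ t in T..(2 * T), ‖P t‖ ^ 2) _
    _ ≤ (E * (S + D₁ + D₂) * g + E * (1 + E) * g) + (D₁ + D₂) * g :=
      add_le_add (hdiff.trans (add_le_add hεP hεε)) hPS
    _ = _ := by ring

/-- The mean square formula with the error term `O(T^{2-2α} log T)`, for every `α < 1` such that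
the coefficients on the line are `O(k^{-α})`. -/
lemma avZeta_mean_square_isBigO (s₁ s₂ : ℂ) {σ₃ α : ℝ} (hσ₁ : 0 ≤ s₁.re)
    (hα0 : 1 / 2 < α) (hα1 : α < 1) (ha : α ≤ s₁.re + σ₃) (hb : α < s₁.re + s₂.re + σ₃ - 1)
    (havoid : ∀ t : ℝ, 2 ≤ t →
      s₁ + ((σ₃ : ℂ) + t * Complex.I) ≠ 1 ∧ s₁ + s₂ + ((σ₃ : ℂ) + t * Complex.I) ≠ 2) :
    (fun T : ℝ =>
        ((∫ t in (2 : ℝ)..T, ‖avZeta s₁ s₂ ((σ₃ : ℂ) + t * Complex.I)‖ ^ 2 : ℝ) : ℂ)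
          - avSquare s₁ s₂ ((2 * σ₃ : ℝ) : ℂ) * T)
        =O[atTop] fun T : ℝ => T ^ (2 - 2 * α) * Real.log T := by
  obtain ⟨-, C, hC, T₁, hT₁, h⟩ := exists_dyadic_mean_square s₁ s₂ hσ₁ hα0 hα1 ha hb havoid
  have := isBigO_integral_sub_of_dyadic (fun t => sq_nonneg _)
    (fun T hT => intervalIntegrable_norm_avZeta_sq (by linarith) (by linarith) havoid le_rfl hT)
    (by linarith : 0 < 2 - 2 * α) hC hT₁ h
  refine IsBigO.of_norm_left ?_
  refine this.norm_left.congr_left fun T => ?_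
  rw [← Complex.norm_real]
  congr 1
  rw [avSquare]
  simp only [avSquareTerm_eq]
  push_cast
  rfl

lemma summable_avSquareTerm (s₁ s₂ : ℂ) {σ₃ α : ℝ} (hσ₁ : 0 ≤ s₁.re)
    (hα0 : 1 / 2 < α) (hα1 : α < 1) (ha : α ≤ s₁.re + σ₃) (hb : α < s₁.re + s₂.re + σ₃ - 1)
    (havoid : ∀ t : ℝ, 2 ≤ t →
      s₁ + ((σ₃ : ℂ) + t * Complex.I) ≠ 1 ∧ s₁ + s₂ + ((σ₃ : ℂ) + t * Complex.I) ≠ 2) :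
    Summable (avSquareTerm s₁ s₂ ((2 * σ₃ : ℝ) : ℂ)) := by
  have h := (exists_dyadic_mean_square s₁ s₂ hσ₁ hα0 hα1 ha hb havoid).1
  refine (Complex.summable_ofReal.2 h).congr fun k => ?_
  rw [avSquareTerm_eq]

/-! ### The choice of the exponent in the three cases. -/

lemma rpow_mul_log_isBigO_rpow {p q : ℝ} (h : p < q) :
    (fun T : ℝ => T ^ p * Real.log T) =O[atTop] fun T : ℝ => T ^ q := by
  have h1 : (fun T : ℝ => T ^ p * Real.log T) =O[atTop] fun T : ℝ => T ^ p * T ^ (q - p) :=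
    (isBigO_refl _ _).mul (isLittleO_log_rpow_atTop (by linarith)).isBigO
  refine h1.congr' EventuallyEq.rfl ?_
  filter_upwards [eventually_gt_atTop 0] with T hT
  rw [← Real.rpow_add hT]
  congr 1; ring

theorem theorem1p3 (s₁ s₂ : ℂ) (σ₃ : ℝ)
    (hσ₁ : 0 ≤ s₁.re) (ht₁ : 0 ≤ s₁.im) (hσ₃ : 0 < σ₃)
    (h₁₃ : 1 / 2 < s₁.re + σ₃)
    (hlow : 3 / 2 < s₁.re + s₂.re + σ₃) (hupp : s₁.re + s₂.re + σ₃ ≤ 2)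
    (havoid : ∀ t : ℝ, 2 ≤ t →
      s₁ + ((σ₃ : ℂ) + t * Complex.I) ≠ 1 ∧ s₁ + s₂ + ((σ₃ : ℂ) + t * Complex.I) ≠ 2) :
    -- the series of the main term converges absolutely, and the integral exists
    Summable (avSquareTerm s₁ s₂ ((2 * σ₃ : ℝ) : ℂ)) ∧
    (∀ T : ℝ, 2 ≤ T → IntervalIntegrable
      (fun t : ℝ => ‖avZeta s₁ s₂ ((σ₃ : ℂ) + t * Complex.I)‖ ^ 2) MeasureTheory.volume 2 T) ∧
    -- the mean square formula, with the error term of each of the three cases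
    (1 / 2 + s₁.re + σ₃ ≤ s₂.re →
      (fun T : ℝ =>
        ((∫ t in (2 : ℝ)..T, ‖avZeta s₁ s₂ ((σ₃ : ℂ) + t * Complex.I)‖ ^ 2 : ℝ) : ℂ)
          - avSquare s₁ s₂ ((2 * σ₃ : ℝ) : ℂ) * T)
        =O[atTop] fun T : ℝ => T ^ (2 - 2 * s₁.re - 2 * σ₃) * Real.log T) ∧
    (s₂.re < 1 / 2 + s₁.re + σ₃ → s₁.re + s₂.re + σ₃ < 2 →
      (fun T : ℝ =>
        ((∫ t in (2 : ℝ)..T, ‖avZeta s₁ s₂ ((σ₃ : ℂ) + t * Complex.I)‖ ^ 2 : ℝ) : ℂ)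
          - avSquare s₁ s₂ ((2 * σ₃ : ℝ) : ℂ) * T)
        =O[atTop] fun T : ℝ => T ^ (5 / 2 - s₁.re - s₂.re - σ₃)) ∧
    (s₂.re < 1 / 2 + s₁.re + σ₃ → s₁.re + s₂.re + σ₃ = 2 →
      (fun T : ℝ =>
        ((∫ t in (2 : ℝ)..T, ‖avZeta s₁ s₂ ((σ₃ : ℂ) + t * Complex.I)‖ ^ 2 : ℝ) : ℂ)
          - avSquare s₁ s₂ ((2 * σ₃ : ℝ) : ℂ) * T)
        =O[atTop] fun T : ℝ => (T * Real.log T) ^ (1 / 2 : ℝ)) := by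

  set b := s₁.re + s₂.re + σ₃ with hb
  have hsmall : ∀ α : ℝ, 1 / 2 < α → α < 1 → α ≤ s₁.re + σ₃ → α < b - 1 →
      (fun T : ℝ =>
        ((∫ t in (2 : ℝ)..T, ‖avZeta s₁ s₂ ((σ₃ : ℂ) + t * Complex.I)‖ ^ 2 : ℝ) : ℂ)
          - avSquare s₁ s₂ ((2 * σ₃ : ℝ) : ℂ) * T)
        =O[atTop] fun T : ℝ => T ^ (2 - 2 * α) * Real.log T := fun α h1 h2 h3 h4 =>
    avZeta_mean_square_isBigO s₁ s₂ hσ₁ h1 h2 h3 h4 havoid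
  have hmain : s₂.re < 1 / 2 + s₁.re + σ₃ →
      (fun T : ℝ =>
        ((∫ t in (2 : ℝ)..T, ‖avZeta s₁ s₂ ((σ₃ : ℂ) + t * Complex.I)‖ ^ 2 : ℝ) : ℂ)
          - avSquare s₁ s₂ ((2 * σ₃ : ℝ) : ℂ) * T)
        =O[atTop] fun T : ℝ => T ^ (5 / 2 - s₁.re - s₂.re - σ₃) := by
    intro h
    -- The value α = b/2 - 1/4 would give exactly 2 - 2α = 5/2 - b; a slightly larger α removes the
    -- logarithm. The three inequalities amount to σ₂ < 1/2 + a, b > 3/2 and b < 5/2.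
    have hlt : b / 2 - 1 / 4 < min (s₁.re + σ₃) (min (b - 1) 1) :=
      lt_min (by linarith) (lt_min (by linarith) (by linarith))
    obtain ⟨α, hα1, hα2⟩ := exists_between hlt
    rw [lt_min_iff, lt_min_iff] at hα2
    exact (hsmall α (by linarith) hα2.2.2 hα2.1.le hα2.2.1).trans
      (rpow_mul_log_isBigO_rpow (by linarith))
  refine ⟨?_, ?_, ?_, ?_, ?_⟩
  · have hlt : 1 / 2 < min (s₁.re + σ₃) (min (b - 1) 1) :=
      lt_min h₁₃ (lt_min (by linarith) (by norm_num))
    obtain ⟨α, hα1, hα2⟩ := exists_between hlt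
    rw [lt_min_iff, lt_min_iff] at hα2
    exact summable_avSquareTerm s₁ s₂ hσ₁ hα1 hα2.2.2 hα2.1.le hα2.2.1 havoid
  · intro T hT
    exact intervalIntegrable_norm_avZeta_sq (by linarith) (by linarith) havoid le_rfl hT
  · intro h
    -- The case condition gives b ≥ 2a + 1/2. With a > 1/2 this yields a < b - 1, and with b ≤ 2 it
    -- yields a ≤ 3/4 < 1.
    have := hsmall (s₁.re + σ₃) h₁₃ (by linarith) le_rfl (by linarith)
    rwa [mul_add, ← sub_sub] at this
  · exact fun h _ => hmain h
  · intro h h2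
    refine (hmain h).trans (IsBigO.of_bound 1 ?_)
    filter_upwards [eventually_ge_atTop (Real.exp 1)] with T hT
    have hT0 : 0 < T := (Real.exp_pos 1).trans_le hT
    have hlog : 1 ≤ Real.log T := (Real.le_log_iff_exp_le hT0).2 hT
    have e : 5 / 2 - s₁.re - s₂.re - σ₃ = 1 / 2 := by linarith
    rw [e, one_mul, Real.norm_of_nonneg (by positivity), Real.norm_of_nonneg (by positivity)]
    gcongr
    exact le_mul_of_one_le_right hT0.le hlog
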